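/- Let $c_l=1$ for integers $l\le 0$ and $c_l=0$ for integers $l>0$. Let $S=(S(t))_{t\ge 0}$ be the Lévy process that arises as the limit of the normalised Petersburg random walk, that is, a Lévy process ($S(0)=0$ a.s., independent and stationary increments, continuous in probability) with $$E\,e^{izS(t)}=\exp\Big(t\sum_{k\in\mathbb Z}2^{-k}\big(e^{iz2^k}-1-iz2^kc_k\big)\Big),\qquad t\ge 0,\ z\in\mathbb R .$$ Let $a>0$. Then the integral $U=\int_0^\infty e^{-2at}\,dS(t)$ exists, where $\int_0^T e^{-2at}\,dS(t)$ is the limit in probability of the Riemann–Stieltjes sums over tagged partitions of $[0,T]$ as the mesh tends to $0$, and $U$ is the limit in probability of these integrals as $T\to\infty$. Moreover: 1. $U$ is infinitely divisible, and $E\,e^{izU}=e^{g(z)/(2a)}$ for all $z\in\mathbb R$, where $$g(z)=2iz+\sum_{l\in\mathbb Z}2^{-l}\int_{2^l}^{2^{l+1}}\big(e^{izx}-1-izx\,c_l\big)\frac{dx}{x},$$ the series being absolutely convergent. 2. The Lévy measure of $U$ is $L(dx)=2^{-l}\,\dfrac{dx}{2ax}$ on $(2^l,2^{l+1})$, $l\in\mathbb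 Z$ (with no mass elsewhere). 3. On a suitable enlargement of the probability space there are independent random variables $W_l$, $l\in\mathbb Z$, such that almost surely $$U=\frac{2}{2a}+\sum_{l\in\mathbb Z}2^lW_l$$ with unconditional convergence of the series, where $W_l+c_l\,2^{-l}/(2a)$ is compound Poisson (so $W_l$ is compound Poisson for $l>0$ and a compound Poisson variable minus its mean for $l\le 0$) and $$E\,e^{izW_l}=\exp\Big(\frac{2^{-l}}{2a}\int_1^2\big(e^{izx}-1-izx\,c_l\big)\frac{dx}{x}\Big),\qquad z\in\mathbb R .$$ -/

import Mathlib

open MeasureTheory ProbabilityTheory Filter Topology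
open scoped NNReal ENNReal

universe u

namespace Petersburg

noncomputable section

/-- Lévy processes: `S 0 = 0` almost surely, independent and stationary increments,
continuity in probability. No path regularity is required. -/
structure IsLevyProcess {Ω : Type*} [MeasurableSpace Ω] (S : ℝ≥0 → Ω → ℝ) (μ : Measure Ω) :
    Prop where
  measurable : ∀ t, Measurable (S t)
  start_zero : ∀ᵐ ω ∂μ, S 0 ω = 0
  indep_increments : HasIndepIncrements S μ
  stationary_increments : ∀ s t : ℝ≥0, μ.map (fun ω => S (s + t) ω - S s ω) = μ.map (S t)
  continuous_in_probability : ∀ t : ℝ≥0, TendstoInMeasure μ S (𝓝 t) (S t)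

/-- The centering constants: `c l = 1` for `l ≤ 0` and `c l = 0` for `l > 0`. -/
def c (l : ℤ) : ℝ := if l ≤ 0 then 1 else 0

/-- The exponent `∑_{k ≤ 0} 2^{-k} (e^{iz2^k} - 1 - iz2^k) + ∑_{k > 0} 2^{-k} (e^{iz2^k} - 1)`,
i.e. Lévy measure with mass `2^{-k}` at `2^k`, `k ∈ ℤ`, the jumps of size at most `1` centered. -/
def levyExponent (z : ℝ) : ℂ :=
  ∑' k : ℤ, (2 : ℂ) ^ (-k) *
    (Complex.exp (Complex.I * z * (2 : ℂ) ^ k) - 1 - Complex.I * z * (2 : ℂ) ^ k * c k)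

/-- The Lévy process `S` arising as limit of the Petersburg random walk: the Lévy process with
`E e^{izS(t)} = e^{t l(z)}`, where `l` is `levyExponent`. -/
structure IsPetersburgProcess {Ω : Type*} [MeasurableSpace Ω] (S : ℝ≥0 → Ω → ℝ)
    (μ : Measure Ω) : Prop extends IsLevyProcess S μ where
  charFun_eq : ∀ (t : ℝ≥0) (z : ℝ),
    charFun (μ.map (S t)) z = Complex.exp (((t : ℝ) : ℂ) * levyExponent z)

/-- `I` is the stochastic integral `∫_0^T f(t) dS(t)` of the deterministic function `f`: the limit
in probability, as the mesh tends to zero, of the Riemann-Stieltjes sums over the tagged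
partitions `0 = t 0 ≤ t 1 ≤ ... ≤ t n = T`, with tags `ξ i ∈ [t i, t (i+1)]`. -/
def IsIntegralOn {Ω : Type*} [MeasurableSpace Ω] (f : ℝ≥0 → ℝ) (S : ℝ≥0 → Ω → ℝ)
    (μ : Measure Ω) (T : ℝ≥0) (I : Ω → ℝ) : Prop :=
  AEMeasurable I μ ∧
    ∀ ε : ℝ, 0 < ε → ∀ η : ℝ, 0 < η → ∃ δ : ℝ≥0, 0 < δ ∧
      ∀ (n : ℕ) (t ξ : ℕ → ℝ≥0), Monotone t → t 0 = 0 → t n = T →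
        (∀ i < n, t (i + 1) ≤ t i + δ) → (∀ i < n, ξ i ∈ Set.Icc (t i) (t (i + 1))) →
          μ {ω | ε ≤ |∑ i ∈ Finset.range n, f (ξ i) * (S (t (i + 1)) ω - S (t i) ω) - I ω|}
            ≤ ENNReal.ofReal η

/-- `U` is the improper stochastic integral `∫_0^∞ f(t) dS(t)`: the limit in probability of
`∫_0^T f(t) dS(t)` as `T → ∞`. -/
def IsImproperIntegral {Ω : Type*} [MeasurableSpace Ω] (f : ℝ≥0 → ℝ) (S : ℝ≥0 → Ω → ℝ)
    (μ : Measure Ω) (U : Ω → ℝ) : Prop :=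
  AEMeasurable U μ ∧ ∃ I : ℝ≥0 → Ω → ℝ,
    (∀ T, IsIntegralOn f S μ T (I T)) ∧ TendstoInMeasure μ I atTop U

/-- The law of the sum of `n` independent random variables with law `ρ`. -/
def iidSumLaw (ρ : Measure ℝ) (n : ℕ) : Measure ℝ :=
  (Measure.pi (fun _ : Fin n => ρ)).map (fun x => ∑ i, x i)

/-- Infinite divisibility of a law on `ℝ`. -/
def IsInfinitelyDivisible (m : Measure ℝ) : Prop :=
  ∀ n : ℕ, 0 < n → ∃ ρ : Measure ℝ, IsProbabilityMeasure ρ ∧ iidSumLaw ρ n = m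

/-- `m` is a compound Poisson law: the law of the sum of `N` independent variables with law `ρ`,
where `N` is an independent Poisson variable with mean `r`. -/
def IsCompoundPoisson (m : Measure ℝ) : Prop :=
  ∃ (r : ℝ≥0) (ρ : Measure ℝ), 0 < r ∧ IsProbabilityMeasure ρ ∧
    m = (poissonMeasure r).bind (iidSumLaw ρ)

/-- `ν` is the Lévy measure of the infinitely divisible law `m` (Lévy-Khintchine formula). -/
def HasLevyMeasure (m ν : Measure ℝ) : Prop :=
  ν {0} = 0 ∧ ∫⁻ x, ENNReal.ofReal (min 1 (x ^ 2)) ∂ν < ∞ ∧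
    ∃ b σ : ℝ, ∀ z : ℝ, charFun m z = Complex.exp (Complex.I * b * z - (σ : ℂ) ^ 2 * z ^ 2 / 2 +
      ∫ x : ℝ, (Complex.exp (Complex.I * z * x) - 1 -
        Set.indicator (Set.Icc (-1 : ℝ) 1) (fun y : ℝ => Complex.I * z * y) x) ∂ν)

/-- The term `2^{-l} ∫_{2^l}^{2^{l+1}} (e^{izx} - 1 - izx c_l) dx/x`. -/
def gTerm (z : ℝ) (l : ℤ) : ℂ :=
  (2 : ℂ) ^ (-l) * ∫ x in ((2 : ℝ) ^ l)..((2 : ℝ) ^ (l + 1)),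
    (Complex.exp (Complex.I * z * x) - 1 - Complex.I * z * x * c l) / x

/-- `g(z) = 2iz + ∑_l 2^{-l} ∫_{2^l}^{2^{l+1}} (e^{izx} - 1 - izx c_l) dx/x`. -/
def g (z : ℝ) : ℂ := 2 * Complex.I * z + ∑' l : ℤ, gTerm z l

/-- The measure `2^{-l} dx / (2ax)` on `(2^l, 2^{l+1})`, `l ∈ ℤ`. -/
def levyMeasureU (a : ℝ) : Measure ℝ :=
  Measure.sum fun l : ℤ =>
    (volume.restrict (Set.Ioo ((2 : ℝ) ^ l) ((2 : ℝ) ^ (l + 1)))).withDensity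
      (fun x => ENNReal.ofReal ((2 : ℝ) ^ (-l) / (2 * a * x)))

/-- The characteristic function `exp ((2^{-l}/2a) ∫_1^2 (e^{izx} - 1 - izx c_l) dx/x)`. -/
def charFunW (a : ℝ) (l : ℤ) (z : ℝ) : ℂ :=
  Complex.exp ((2 : ℂ) ^ (-l) / (2 * a) * ∫ x in (1 : ℝ)..2,
    (Complex.exp (Complex.I * z * x) - 1 - Complex.I * z * x * c l) / x)

end

end Petersburg

/-! Write ψ for `levyExponent`. Everything is read off characteristic functions, and two facts about
ψ carry the argument.

Size: |ψ(z)| ≤ C(√|z| + z²), with the k-th term of the series decaying like 2^{-|k|/2}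
(`norm_levyTerm_le`). For a nonrandom step function, independence and stationarity of increments
give the exponent ∑ (t_{i+1} - t_i) ψ(α_i z), which is small when the coefficients α_i are small.
The truncation inequality turns a small exponent into a small probability
(`measure_le_abs_of_charFun_eq_exp`). Two Riemann–Stieltjes sums of a Lipschitz integrand over fine
partitions differ by a step sum with small coefficients on a common refinement, so the sums are
Cauchy in probability (`IsPetersburgProcess.stieltjesSum_cauchy`). In the limit, the integral of φ
over [A, B] has exponent ∫_A^B ψ(zφ(t)) dt.

Scaling: ψ(2z) = 2ψ(z) - 2iz (`levyExponent_two_mul`). Since g(z) = 2iz + ∫_1^2 ψ(zx) dx/x, it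
follows that t ↦ g(ze^{-bt}) has derivative -bψ(ze^{-bt}). Hence ∫_A^B ψ(ze^{-2at}) dt is the
difference of the values of g(ze^{-2at})/(2a) at A and B. As g tends to 0 at 0, the improper
integral exists and has exponent g(z)/(2a).

The rest uses this exponent only. Replacing a by na yields an n-th convolution root. Comparing the
cut-offs c_l with the cut-off at 1 gives the Lévy measure. For the series, independent W_l are built
on a product space, where the sum converges almost surely by Borel–Cantelli and, up to the constant,
has the law of U. A conditional distribution then glues the family (W_l) to the given U
(`exists_enlargement`). -/

namespace Petersburg

/-! ### The Lévy exponent: size, continuity and dyadic scaling -/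

/-- The `k`-th term of the series defining `levyExponent`. -/
noncomputable def levyTerm (z : ℝ) (k : ℤ) : ℂ :=
  (2 : ℂ) ^ (-k) *
    (Complex.exp (Complex.I * z * (2 : ℂ) ^ k) - 1 - Complex.I * z * (2 : ℂ) ^ k * c k)

/-- The modulus controlling `levyExponent` near the origin and at infinity. -/
noncomputable def modulus (z : ℝ) : ℝ := √|z| + z ^ 2

lemma modulus_nonneg (z : ℝ) : 0 ≤ modulus z := by unfold modulus; positivity

lemma modulus_mono {y z : ℝ} (h : |y| ≤ |z|) : modulus y ≤ modulus z := by
  unfold modulus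
  have := sq_le_sq.2 h
  gcongr

lemma continuous_modulus : Continuous modulus := by unfold modulus; fun_prop

@[simp] lemma modulus_zero : modulus 0 = 0 := by simp [modulus]

lemma modulus_le_of_le_inv {r z : ℝ} (hr : 0 < r) (hr1 : r ≤ 1) (hz : |z| ≤ r⁻¹) :
    modulus z ≤ 2 * r⁻¹ ^ 2 := by
  have h1 : 1 ≤ r⁻¹ := (one_le_inv₀ hr).2 hr1
  have h2 : √|z| ≤ r⁻¹ ^ 2 := by
    rw [Real.sqrt_le_left (by positivity)]
    calc |z| ≤ r⁻¹ := hz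
      _ ≤ r⁻¹ ^ 4 := le_self_pow₀ h1 (by norm_num)
      _ = (r⁻¹ ^ 2) ^ 2 := by ring
  have h3 : z ^ 2 ≤ r⁻¹ ^ 2 := by
    rw [← sq_abs z]; gcongr
  unfold modulus
  linarith

/-- Interpolates between the bounds |y| and 2: the square is at most 2|y|. -/
lemma norm_exp_sub_one_le_sqrt (y : ℝ) :
    ‖Complex.exp (Complex.I * y) - 1‖ ≤ √2 * √|y| := by
  have h1 := Real.norm_exp_I_mul_ofReal_sub_one_le (x := y)
  have h2 : ‖Complex.exp (Complex.I * y) - 1‖ ≤ 2 := by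
    calc _ ≤ ‖Complex.exp (Complex.I * y)‖ + ‖(1 : ℂ)‖ := norm_sub_le _ _
      _ = 2 := by rw [mul_comm, Complex.norm_exp_ofReal_mul_I]; norm_num
  rw [← Real.sqrt_mul (by norm_num)]
  apply Real.le_sqrt_of_sq_le
  rw [Real.norm_eq_abs] at h1
  nlinarith [norm_nonneg (Complex.exp (Complex.I * y) - 1)]

lemma norm_exp_sub_one_sub_le_sq (y : ℝ) :
    ‖Complex.exp (Complex.I * y) - 1 - Complex.I * y‖ ≤ 3 * y ^ 2 := by
  have hn : ‖Complex.I * y‖ = |y| := by simp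
  by_cases h : |y| ≤ 1
  · have := Complex.norm_exp_sub_one_sub_id_le (x := Complex.I * y) (by rwa [hn])
    rw [hn, sq_abs] at this
    nlinarith [sq_nonneg y]
  · push Not at h
    have h2 : ‖Complex.exp (Complex.I * y) - 1‖ ≤ 2 := by
      calc _ ≤ ‖Complex.exp (Complex.I * y)‖ + ‖(1 : ℂ)‖ := norm_sub_le _ _
        _ = 2 := by rw [mul_comm, Complex.norm_exp_ofReal_mul_I]; norm_num
    calc _ ≤ ‖Complex.exp (Complex.I * y) - 1‖ + ‖Complex.I * y‖ := norm_sub_le _ _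
      _ ≤ 2 + |y| := by rw [hn]; gcongr
      _ ≤ 3 * y ^ 2 := by rw [← sq_abs]; nlinarith

lemma levyTerm_eq_of_nonpos (z : ℝ) (n : ℕ) :
    levyTerm z (-n) = (2 : ℂ) ^ n *
      (Complex.exp (Complex.I * ((z * 2⁻¹ ^ n : ℝ) : ℂ)) - 1
        - Complex.I * ((z * 2⁻¹ ^ n : ℝ) : ℂ)) := by
  simp [levyTerm, c, mul_assoc]

lemma levyTerm_eq_of_pos (z : ℝ) {n : ℕ} (hn : 0 < n) :
    levyTerm z n = (2 : ℂ)⁻¹ ^ n *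
      (Complex.exp (Complex.I * ((z * 2 ^ n : ℝ) : ℂ)) - 1) := by
  have : ¬ ((n : ℤ) ≤ 0) := by omega
  simp only [levyTerm, c, this]
  simp [mul_assoc]

lemma inv_two_pow_mul_sqrt (n : ℕ) : (2 : ℝ)⁻¹ ^ n * √(2 ^ n) = (√2)⁻¹ ^ n := by
  have : √((2 : ℝ) ^ n) = √2 ^ n := by
    rw [Real.sqrt_eq_iff_mul_self_eq (by positivity) (by positivity), ← mul_pow]
    simp
  rw [this, ← mul_pow]
  congr 1
  have h := Real.mul_self_sqrt (show (0 : ℝ) ≤ 2 by norm_num)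
  have : √2 ≠ 0 := by positivity
  field_simp
  nlinarith

lemma inv_two_le_inv_sqrt_two : (2 : ℝ)⁻¹ ≤ (√2)⁻¹ := by
  apply inv_anti₀ (by positivity)
  rw [Real.sqrt_le_left (by norm_num)]; norm_num

/-- For k ≤ 0 the second-order Taylor bound gives 2^{|k|}(z2^{-|k|})² = z²2^{-|k|}. For k > 0 the
bound |e^{iy} - 1| ≤ |y| would leave no decay in k, as S has no first moment; the square-root bound
leaves 2^{-k}2^{k/2}. -/
lemma norm_levyTerm_le (z : ℝ) (k : ℤ) :
    ‖levyTerm z k‖ ≤ 3 * modulus z * (√2)⁻¹ ^ k.natAbs := by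
  have hs : √2 ≤ 3 := by rw [Real.sqrt_le_left (by norm_num)]; norm_num
  by_cases hk : k ≤ 0
  · obtain ⟨n, rfl⟩ : ∃ n : ℕ, k = -n := ⟨k.natAbs, by omega⟩
    rw [levyTerm_eq_of_nonpos, norm_mul, Int.natAbs_neg, Int.natAbs_natCast, norm_pow]
    calc ‖(2 : ℂ)‖ ^ n * _ ≤ 2 ^ n * (3 * (z * 2⁻¹ ^ n) ^ 2) := by
          rw [Complex.norm_ofNat]
          gcongr
          exact norm_exp_sub_one_sub_le_sq _
      _ = 3 * z ^ 2 * (2 ^ n * 2⁻¹ ^ n) * 2⁻¹ ^ n := by ring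
      _ = 3 * z ^ 2 * 2⁻¹ ^ n := by rw [← mul_pow]; norm_num
      _ ≤ 3 * modulus z * (√2)⁻¹ ^ n := by
          have := inv_two_le_inv_sqrt_two
          gcongr
          · have := modulus_nonneg z; positivity
          · unfold modulus; have := Real.sqrt_nonneg |z|; linarith
  · obtain ⟨n, rfl⟩ : ∃ n : ℕ, k = n := ⟨k.natAbs, by omega⟩
    rw [levyTerm_eq_of_pos z (by omega), norm_mul, Int.natAbs_natCast, norm_pow]
    calc ‖(2 : ℂ)⁻¹‖ ^ n * _ ≤ 2⁻¹ ^ n * (√2 * √|z * 2 ^ n|) := by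
          rw [norm_inv, Complex.norm_ofNat]
          gcongr
          exact norm_exp_sub_one_le_sqrt _
      _ = √2 * √|z| * (2⁻¹ ^ n * √(2 ^ n)) := by
          rw [abs_mul, abs_of_pos (show (0 : ℝ) < 2 ^ n by positivity), Real.sqrt_mul (abs_nonneg z)]
          ring
      _ = √2 * √|z| * (√2)⁻¹ ^ n := by rw [inv_two_pow_mul_sqrt]
      _ ≤ 3 * modulus z * (√2)⁻¹ ^ n := by
          gcongr
          unfold modulus; nlinarith [sq_nonneg z]

lemma summable_pow_natAbs {q : ℝ} (h0 : 0 ≤ q) (h1 : q < 1) :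
    Summable fun k : ℤ => q ^ k.natAbs := by
  apply Summable.of_nat_of_neg <;> simpa using summable_geometric_of_lt_one h0 h1

lemma inv_sqrt_two_lt_one : (√2)⁻¹ < 1 := by
  apply inv_lt_one_of_one_lt₀
  rw [Real.lt_sqrt] <;> norm_num

lemma summable_inv_sqrt_two_pow : Summable fun k : ℤ => (√2)⁻¹ ^ k.natAbs :=
  summable_pow_natAbs (by positivity) inv_sqrt_two_lt_one

lemma summable_levyTerm (z : ℝ) : Summable (levyTerm z) :=
  .of_norm_bounded (summable_inv_sqrt_two_pow.mul_left _) (norm_levyTerm_le z)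

/-- The constant in the bound of `levyExponent` by `modulus`. -/
noncomputable def levyConst : ℝ := 3 * ∑' k : ℤ, (√2)⁻¹ ^ k.natAbs

lemma levyConst_nonneg : 0 ≤ levyConst := by unfold levyConst; positivity

lemma levyExponent_eq (z : ℝ) : levyExponent z = ∑' k, levyTerm z k := rfl

lemma norm_levyExponent_le (z : ℝ) : ‖levyExponent z‖ ≤ levyConst * modulus z := by
  rw [levyExponent_eq]
  refine (tsum_of_norm_bounded (summable_inv_sqrt_two_pow.mul_left (3 * modulus z)).hasSum
    (norm_levyTerm_le z)).trans_eq ?_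
  rw [tsum_mul_left, levyConst]; ring

lemma continuous_levyTerm (k : ℤ) : Continuous fun z => levyTerm z k := by
  unfold levyTerm; fun_prop

lemma continuous_levyExponent : Continuous levyExponent := by
  rw [continuous_iff_continuousAt]
  intro z
  have : ContinuousOn levyExponent (Set.Ioo (-(|z| + 1)) (|z| + 1)) := by
    refine continuousOn_tsum (fun k => (continuous_levyTerm k).continuousOn)
      (summable_inv_sqrt_two_pow.mul_left (3 * modulus (|z| + 1))) fun k x hx => ?_
    refine (norm_levyTerm_le x k).trans ?_
    have := modulus_mono (y := x) (z := |z| + 1) (by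
      rw [abs_of_pos (show 0 < |z| + 1 by positivity)]; exact (abs_lt.2 hx).le)
    gcongr
  exact this.continuousAt (Ioo_mem_nhds (by linarith [neg_abs_le z]) (by linarith [le_abs_self z]))

/-- Doubling z shifts the index by one. The centering is not shift invariant: c_k and c_{k+1} differ
exactly at k = 0, which produces the drift. -/
lemma levyTerm_two_mul (z : ℝ) (k : ℤ) :
    levyTerm (2 * z) k = 2 * levyTerm z (k + 1) + if k = 0 then -(2 * Complex.I * z) else 0 := by
  have h2 : (2 : ℂ) ^ (-(k + 1)) * 2 ^ (k + 1) = 1 := by rw [← zpow_add₀ two_ne_zero]; simp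
  have h3 : (2 : ℂ) ^ (-k) = 2 * 2 ^ (-(k + 1)) := by
    rw [← zpow_one_add₀ two_ne_zero]; ring_nf
  have h4 : (2 : ℂ) ^ (k + 1) = 2 ^ k * 2 := zpow_add_one₀ two_ne_zero k
  have h5 : (c k : ℂ) = c (k + 1) + if k = 0 then 1 else 0 := by
    unfold c
    split_ifs <;> first | omega | simp
  simp only [levyTerm]
  rw [h3, h5]
  have h6 : Complex.I * ((2 * z : ℝ) : ℂ) * 2 ^ k = Complex.I * z * 2 ^ (k + 1) := by
    rw [h4]; push_cast; ring
  rw [h6]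
  split_ifs
  · linear_combination (-2 * Complex.I * z) * h2
  · ring

lemma levyExponent_two_mul (z : ℝ) :
    levyExponent (2 * z) = 2 * levyExponent z - 2 * Complex.I * z := by
  have h1 : HasSum (fun k => levyTerm z (k + 1)) (levyExponent z) :=
    (Equiv.addRight (1 : ℤ)).hasSum_iff.2 (summable_levyTerm z).hasSum
  have h2 := (h1.mul_left 2).add (hasSum_ite_eq (0 : ℤ) (-(2 * Complex.I * (z : ℂ))))
  have h3 := (summable_levyTerm (2 * z)).hasSum
  simp_rw [levyTerm_two_mul] at h3
  rw [levyExponent_eq]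
  simp_rw [levyTerm_two_mul]
  rw [h2.tsum_eq]; ring

/-! ### The function g as a primitive of the exponent along exponentials -/

lemma gTerm_eq (z : ℝ) (l : ℤ) :
    gTerm z l = ∫ x in (1 : ℝ)..2, levyTerm (z * x) l / x := by
  have h2 : (2 : ℝ) ^ l ≠ 0 := by positivity
  have h := intervalIntegral.integral_comp_mul_left (a := 1) (b := 2) (c := (2 : ℝ) ^ l)
    (fun x : ℝ => (Complex.exp (Complex.I * z * x) - 1 - Complex.I * z * x * c l) / x) h2
  rw [mul_one, ← zpow_add_one₀ two_ne_zero] at h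
  rw [gTerm]
  have h' : (∫ x in ((2 : ℝ) ^ l)..((2 : ℝ) ^ (l + 1)),
    (Complex.exp (Complex.I * z * x) - 1 - Complex.I * z * x * c l) / x) =
    (2 : ℂ) ^ l * ∫ x in (1 : ℝ)..2, (Complex.exp (Complex.I * z * ((2 ^ l * x : ℝ) : ℂ)) - 1 -
      Complex.I * z * ((2 ^ l * x : ℝ) : ℂ) * c l) / ((2 ^ l * x : ℝ) : ℂ) := by
    rw [h, Complex.real_smul]
    push_cast
    rw [mul_inv_cancel_left₀ (zpow_ne_zero _ two_ne_zero)]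
  rw [h', ← intervalIntegral.integral_const_mul, ← intervalIntegral.integral_const_mul]
  refine intervalIntegral.integral_congr fun x hx => ?_
  rw [Set.uIcc_of_le (by norm_num)] at hx
  have hx0 : (x : ℂ) ≠ 0 := by
    have : x ≠ 0 := by linarith [hx.1]
    exact_mod_cast this
  have h2c : (2 : ℂ) ^ l ≠ 0 := zpow_ne_zero _ two_ne_zero
  simp only [levyTerm]
  push_cast
  rw [show Complex.I * z * (2 ^ l * x) = Complex.I * (z * x) * 2 ^ l by ring]
  field_simp

lemma norm_levyTerm_div_le (z : ℝ) (l : ℤ) {x : ℝ} (hx : x ∈ Set.Ioc (1 : ℝ) 2) :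
    ‖levyTerm (z * x) l / x‖ ≤ 3 * modulus (2 * z) * (√2)⁻¹ ^ l.natAbs := by
  have hx0 : 0 < x := by linarith [hx.1]
  rw [norm_div, Complex.norm_real, Real.norm_of_nonneg hx0.le]
  refine (div_le_self (norm_nonneg _) hx.1.le).trans ((norm_levyTerm_le _ _).trans ?_)
  have := modulus_mono (y := z * x) (z := 2 * z) (by
    rw [abs_mul, abs_mul, abs_of_pos hx0, abs_of_pos (two_pos (α := ℝ)), mul_comm]
    exact mul_le_mul_of_nonneg_right hx.2 (abs_nonneg z))
  gcongr

lemma norm_gTerm_le (z : ℝ) (l : ℤ) :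
    ‖gTerm z l‖ ≤ 3 * modulus (2 * z) * (√2)⁻¹ ^ l.natAbs := by
  rw [gTerm_eq]
  have := intervalIntegral.norm_integral_le_of_norm_le_const (a := (1 : ℝ)) (b := 2)
    (f := fun x : ℝ => levyTerm (z * x) l / x)
    (C := 3 * modulus (2 * z) * (√2)⁻¹ ^ l.natAbs) (fun x hx =>
      norm_levyTerm_div_le z l (by rwa [Set.uIoc_of_le (by norm_num)] at hx))
  norm_num at this
  simpa using this

lemma summable_gTerm (z : ℝ) : Summable (gTerm z) :=
  .of_norm_bounded (summable_inv_sqrt_two_pow.mul_left _) (norm_gTerm_le z)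

lemma tsum_gTerm (z : ℝ) :
    ∑' l, gTerm z l = ∫ x in (1 : ℝ)..2, levyExponent (z * x) / x := by
  simp_rw [gTerm_eq]
  refine (intervalIntegral.hasSum_integral_of_dominated_convergence
    (fun l _ => 3 * modulus (2 * z) * (√2)⁻¹ ^ l.natAbs) (fun l => ?_) (fun l => ?_)
    ?_ ?_ ?_).tsum_eq
  · have := (continuous_levyTerm l).comp (continuous_const_mul z)
    exact (this.measurable.div (by fun_prop)).aestronglyMeasurable
  · exact .of_forall fun x hx => norm_levyTerm_div_le z l
      (by rwa [Set.uIoc_of_le (by norm_num)] at hx)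
  · exact .of_forall fun x _ => summable_inv_sqrt_two_pow.mul_left _
  · exact intervalIntegrable_const
  · exact .of_forall fun x _ => (summable_levyTerm (z * x)).hasSum.div_const _

lemma g_eq (z : ℝ) :
    g z = 2 * Complex.I * z + ∫ x in (1 : ℝ)..2, levyExponent (z * x) / x := by
  rw [g, tsum_gTerm]

lemma norm_g_le (z : ℝ) : ‖g z‖ ≤ 2 * |z| + levyConst * modulus (2 * z) := by
  rw [g]
  refine (norm_add_le _ _).trans (add_le_add (by simp) ?_)
  refine (tsum_of_norm_bounded (summable_inv_sqrt_two_pow.mul_left (3 * modulus (2 * z))).hasSum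
    (norm_gTerm_le z)).trans_eq ?_
  rw [tsum_mul_left, levyConst]; ring

lemma tendsto_g_zero : Tendsto g (𝓝 0) (𝓝 0) := by
  refine squeeze_zero_norm norm_g_le ?_
  have : Continuous fun z : ℝ => 2 * |z| + levyConst * modulus (2 * z) := by
    have := continuous_modulus
    fun_prop
  simpa using this.tendsto 0

/-- The substitution x = e^{b(t-s)} turns dx/x on [1, 2] into b ds on a window of length log 2 / b
ending at t, so that t enters the integral only through its limits. -/
lemma g_mul_exp_eq {b : ℝ} (hb : 0 < b) (z t : ℝ) :
    g (z * Real.exp (-b * t)) = 2 * Complex.I * (z * Real.exp (-b * t) : ℝ) +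
      b * ∫ s in (t - Real.log 2 / b)..t, levyExponent (z * Real.exp (-b * s)) := by
  rw [g_eq]
  congr 1
  set w := z * Real.exp (-b * t)
  have h := intervalIntegral.integral_deriv_smul_comp'' (a := t - Real.log 2 / b) (b := t)
    (f := fun s => Real.exp (b * (t - s))) (f' := fun s => -b * Real.exp (b * (t - s)))
    (g := fun x : ℝ => levyExponent (w * x) / x) (by fun_prop)
    (fun s _ => by
      have : HasDerivAt (fun s => b * (t - s)) (-b) s := by
        simpa using ((hasDerivAt_id s).const_sub t).const_mul b
      simpa [mul_comm] using this.exp.hasDerivWithinAt)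
    (by fun_prop) (by
      refine ContinuousOn.div ?_ (by fun_prop) ?_
      · exact (continuous_levyExponent.comp (continuous_const_mul w)).continuousOn
      · rintro x ⟨s, _, rfl⟩
        exact_mod_cast (Real.exp_pos _).ne')
  have e1 : b * (t - (t - Real.log 2 / b)) = Real.log 2 := by field_simp; ring
  simp only [Function.comp, e1, sub_self, mul_zero, Real.exp_zero,
    Real.exp_log two_pos] at h
  rw [intervalIntegral.integral_symm, ← h, ← intervalIntegral.integral_const_mul,
    ← intervalIntegral.integral_neg]
  refine intervalIntegral.integral_congr fun s _ => ?_
  have e2 : w * Real.exp (b * (t - s)) = z * Real.exp (-b * s) := by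
    rw [mul_assoc, ← Real.exp_add]; ring_nf
  have e3 : (Real.exp (b * (t - s)) : ℂ) ≠ 0 := by exact_mod_cast (Real.exp_pos _).ne'
  simp only [e2, Complex.real_smul]
  push_cast at e3 ⊢
  field_simp

/-- With w = ze^{-bt}, the two ends of the window contribute b(ψ(w) - ψ(2w)) = -bψ(w) + 2ibw by the
scaling relation. The drift 2iz in g is exactly what cancels 2ibw. -/
lemma hasDerivAt_g_mul_exp {b : ℝ} (hb : 0 < b) (z t : ℝ) :
    HasDerivAt (fun t => g (z * Real.exp (-b * t)))
      (-b * levyExponent (z * Real.exp (-b * t))) t := by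
  simp_rw [g_mul_exp_eq hb]
  have hc : Continuous fun s => levyExponent (z * Real.exp (-b * s)) :=
    continuous_levyExponent.comp (by fun_prop)
  set F : ℝ → ℂ := fun t => ∫ s in (0 : ℝ)..t, levyExponent (z * Real.exp (-b * s))
  have hF : ∀ t, HasDerivAt F (levyExponent (z * Real.exp (-b * t))) t := fun t =>
    hc.integral_hasStrictDerivAt 0 t |>.hasDerivAt
  have e : (fun t => 2 * Complex.I * ((z * Real.exp (-b * t) : ℝ) : ℂ) +
      b * ∫ s in (t - Real.log 2 / b)..t, levyExponent (z * Real.exp (-b * s))) =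
      fun t => 2 * Complex.I * ((z * Real.exp (-b * t) : ℝ) : ℂ) +
        b * (F t - F (t - Real.log 2 / b)) := by
    ext t
    rw [intervalIntegral.integral_interval_sub_left (hc.intervalIntegrable _ _)
      (hc.intervalIntegrable _ _)]
  rw [e]
  have h1 : HasDerivAt (fun t => z * Real.exp (-b * t)) (z * (Real.exp (-b * t) * (-b))) t := by
    have : HasDerivAt (fun t => -b * t) (-b) t := by
      simpa using (hasDerivAt_id t).const_mul (-b)
    exact this.exp.const_mul z
  have h2 := (h1.ofReal_comp.const_mul (2 * Complex.I)).add
    (((hF t).sub ((hF (t - Real.log 2 / b)).comp_sub_const t _)).const_mul (b : ℂ))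
  refine h2.congr_deriv ?_
  have e2 : z * Real.exp (-b * (t - Real.log 2 / b)) = 2 * (z * Real.exp (-b * t)) := by
    have : -b * (t - Real.log 2 / b) = Real.log 2 + -b * t := by field_simp; ring
    rw [this, Real.exp_add, Real.exp_log two_pos]; ring
  rw [e2, levyExponent_two_mul]
  push_cast
  ring

lemma integral_levyExponent_mul_exp {b : ℝ} (hb : 0 < b) (z A B : ℝ) :
    ∫ t in A..B, levyExponent (z * Real.exp (-b * t)) =
      (g (z * Real.exp (-b * A)) - g (z * Real.exp (-b * B))) / b := by
  have hc : Continuous fun s => levyExponent (z * Real.exp (-b * s)) :=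
    continuous_levyExponent.comp (by fun_prop)
  have h := intervalIntegral.integral_eq_sub_of_hasDerivAt (a := A) (b := B)
    (fun t _ => hasDerivAt_g_mul_exp hb z t) ((hc.const_mul _).intervalIntegrable _ _)
  rw [intervalIntegral.integral_const_mul] at h
  have : (b : ℂ) ≠ 0 := by exact_mod_cast hb.ne'
  rw [eq_div_iff this]
  linear_combination -h

end Petersburg

/-! ### Convergence in probability through characteristic functions -/

namespace Petersburg

variable {Ω : Type*} [MeasurableSpace Ω] {μ : Measure Ω}

/-- The truncation inequality controls P(|X| > r) by the average of 1 - φ over |z| ≤ 2/r. It is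
applied with r = ε/2, since the event here is the non-strict one. -/
lemma measure_le_abs_of_norm_one_sub_charFun_le [IsProbabilityMeasure μ] {X : Ω → ℝ}
    (hX : AEMeasurable X μ) {ε κ : ℝ} (hε : 0 < ε)
    (h : ∀ z : ℝ, |z| ≤ 4 / ε → ‖1 - charFun (μ.map X) z‖ ≤ κ) :
    μ {ω | ε ≤ |X ω|} ≤ ENNReal.ofReal (2 * κ) := by
  have : IsProbabilityMeasure (μ.map X) := Measure.isProbabilityMeasure_map hX
  have hr : 0 < ε / 2 := by positivity
  have h1 := measureReal_abs_gt_le_integral_charFun (μ := μ.map X) hr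
  have e : 2 * (ε / 2)⁻¹ = 4 / ε := by field_simp; norm_num
  rw [neg_mul, e] at h1
  have hpos : 0 < 4 / ε := by positivity
  have h2 := intervalIntegral.norm_integral_le_of_norm_le_const (a := -(4 / ε)) (b := 4 / ε)
    (f := fun t => 1 - charFun (μ.map X) t) (C := κ) (fun t ht => h t (by
      rw [Set.uIoc_of_le (by linarith)] at ht
      exact abs_le.2 ⟨ht.1.le, ht.2⟩))
  have h3 : (μ.map X).real {x | ε / 2 < |x|} ≤ 2 * κ := by
    calc _ ≤ _ := h1
      _ ≤ 2⁻¹ * (ε / 2) * (κ * |4 / ε - -(4 / ε)|) := by gcongr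
      _ = 2 * κ := by
        rw [sub_neg_eq_add, abs_of_pos (by positivity)]
        field_simp; ring
  calc μ {ω | ε ≤ |X ω|} ≤ μ (X ⁻¹' {x | ε / 2 < |x|}) :=
        measure_mono fun ω (hω : ε ≤ |X ω|) => show ε / 2 < |X ω| by linarith
    _ = (μ.map X) {x | ε / 2 < |x|} :=
        (Measure.map_apply_of_aemeasurable hX
          (measurableSet_lt measurable_const (by fun_prop))).symm
    _ = ENNReal.ofReal ((μ.map X).real {x | ε / 2 < |x|}) := by simp
    _ ≤ _ := ENNReal.ofReal_le_ofReal h3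

lemma measure_le_abs_of_charFun_eq_exp [IsProbabilityMeasure μ] {X : Ω → ℝ}
    (hX : AEMeasurable X μ) {w : ℝ → ℂ} (hw : ∀ z, charFun (μ.map X) z = Complex.exp (w z))
    {ε κ : ℝ} (hε : 0 < ε) (hκ : κ ≤ 1) (h : ∀ z : ℝ, |z| ≤ 4 / ε → ‖w z‖ ≤ κ) :
    μ {ω | ε ≤ |X ω|} ≤ ENNReal.ofReal (4 * κ) := by
  have := measure_le_abs_of_norm_one_sub_charFun_le (κ := 2 * κ) hX hε fun z hz => by
    rw [hw, norm_sub_rev]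
    exact (Complex.norm_exp_sub_one_le ((h z hz).trans hκ)).trans (by gcongr; exact h z hz)
  rwa [← mul_assoc, show (2 : ℝ) * 2 = 4 by norm_num] at this

lemma measure_le_abs_add {X Y : Ω → ℝ} {ε : ℝ} {p q : ℝ≥0∞}
    (hX : μ {ω | ε / 2 ≤ |X ω|} ≤ p) (hY : μ {ω | ε / 2 ≤ |Y ω|} ≤ q) :
    μ {ω | ε ≤ |X ω + Y ω|} ≤ p + q := by
  refine (measure_mono fun ω (hω : ε ≤ |X ω + Y ω|) => ?_).trans
    ((measure_union_le _ _).trans (add_le_add hX hY))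
  by_contra hc
  simp only [Set.mem_union, Set.mem_ofPred_eq, not_or, not_le] at hc
  linarith [abs_add_le (X ω) (Y ω)]

lemma tendstoInMeasure_iff_abs {ι : Type*} {X : ι → Ω → ℝ} {Y : Ω → ℝ} {l : Filter ι} :
    TendstoInMeasure μ X l Y ↔ ∀ ε : ℝ, 0 < ε → ∀ η : ℝ, 0 < η →
      ∀ᶠ i in l, μ {ω | ε ≤ |X i ω - Y ω|} ≤ ENNReal.ofReal η := by
  rw [tendstoInMeasure_iff_dist]
  refine forall₂_congr fun ε _ => ?_
  simp_rw [Real.dist_eq]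
  rw [ENNReal.tendsto_nhds_zero]
  constructor
  · intro h η hη
    exact h _ (by simpa)
  · intro h η hη
    by_cases hη' : η = ∞
    · simp [hη']
    · simpa [ENNReal.ofReal_toReal hη'] using h η.toReal (ENNReal.toReal_pos hη.ne' hη')

/-- A sequence of real random variables that is Cauchy in probability converges in probability. -/
lemma exists_tendstoInMeasure_of_cauchy [IsProbabilityMeasure μ] {X : ℕ → Ω → ℝ}
    (hX : ∀ n, AEMeasurable (X n) μ)
    (h : ∀ ε : ℝ, 0 < ε → ∀ η : ℝ, 0 < η → ∃ N, ∀ m ≥ N, ∀ n ≥ N,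
      μ {ω | ε ≤ |X m ω - X n ω|} ≤ ENNReal.ofReal η) :
    ∃ Y : Ω → ℝ, Measurable Y ∧ TendstoInMeasure μ X atTop Y := by
  -- Along a fast enough subsequence, consecutive differences exceed 2^{-k} with probability at most
  -- 2^{-k}; Borel–Cantelli then gives almost sure convergence.
  obtain ⟨φ, hφ, hφ'⟩ := extraction_forall_of_eventually
    (P := fun (k N : ℕ) => ∀ m ≥ N, ∀ n ≥ N,
      μ {ω | (1 / 2 : ℝ) ^ k ≤ |X m ω - X n ω|} ≤ ENNReal.ofReal ((1 / 2 : ℝ) ^ k)) (fun k => by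
    obtain ⟨N, hN⟩ := h ((1 / 2) ^ k) (by positivity) ((1 / 2) ^ k) (by positivity)
    filter_upwards [eventually_ge_atTop N] with M hM m hm n hn
    exact hN m (hM.trans hm) n (hM.trans hn))
  have hsum : Summable fun k : ℕ => (1 / 2 : ℝ) ^ k := summable_geometric_two
  have hbc : ∀ᵐ ω ∂μ, ∀ᶠ k in atTop,
      ¬ ((1 / 2 : ℝ) ^ k ≤ |X (φ (k + 1)) ω - X (φ k) ω|) := by
    refine ae_eventually_notMem (ne_top_of_le_ne_top ?_ (ENNReal.tsum_le_tsum fun k =>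
      hφ' k (φ (k + 1)) (hφ.monotone (Nat.le_succ k)) (φ k) le_rfl))
    rw [← ENNReal.ofReal_tsum_of_nonneg (fun k => by positivity) hsum]
    exact ENNReal.ofReal_ne_top
  have hconv : ∀ᵐ ω ∂μ, ∃ y, Tendsto (fun k => X (φ k) ω) atTop (𝓝 y) := by
    filter_upwards [hbc] with ω hω
    refine cauchySeq_tendsto_of_complete (cauchySeq_of_summable_dist ?_)
    refine Summable.of_norm_bounded_eventually_nat hsum ?_
    filter_upwards [hω] with k hk
    rw [Real.norm_of_nonneg dist_nonneg, dist_comm, Real.dist_eq]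
    exact (not_le.1 hk).le
  obtain ⟨Y, hY, hlim⟩ := measurable_limit_of_tendsto_metrizable_ae (fun k => hX (φ k)) hconv
  refine ⟨Y, hY, tendstoInMeasure_iff_abs.2 fun ε hε η hη => ?_⟩
  have hsub := tendstoInMeasure_iff_abs.1
    (tendstoInMeasure_of_tendsto_ae (fun k => (hX (φ k)).aestronglyMeasurable) hlim)
    (ε / 2) (by positivity) (η / 2) (by positivity)
  obtain ⟨N, hN⟩ := h (ε / 2) (by positivity) (η / 2) (by positivity)
  obtain ⟨k, hk, hkN⟩ := (hsub.and (hφ.tendsto_atTop.eventually_ge_atTop N)).exists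
  filter_upwards [eventually_ge_atTop N] with n hn
  have := measure_le_abs_add (hN n hn (φ k) hkN) hk
  rw [← ENNReal.ofReal_add (by positivity) (by positivity)] at this
  simpa using this

lemma tendsto_charFun_of_tendstoInMeasure [IsProbabilityMeasure μ] {X : ℕ → Ω → ℝ} {Y : Ω → ℝ}
    (hX : ∀ n, AEMeasurable (X n) μ) (h : TendstoInMeasure μ X atTop Y) (z : ℝ) :
    Tendsto (fun n => charFun (μ.map (X n)) z) atTop (𝓝 (charFun (μ.map Y) z)) :=
  ProbabilityMeasure.tendsto_iff_tendsto_charFun.1 (h.tendstoInDistribution hX).tendsto z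

section Increments

variable {S : ℝ≥0 → Ω → ℝ}

lemma IsPetersburgProcess.charFun_sub (hS : IsPetersburgProcess S μ) {s t : ℝ≥0} (hst : s ≤ t)
    (z : ℝ) :
    charFun (μ.map fun ω => S t ω - S s ω) z =
      Complex.exp (((t : ℝ) - s : ℝ) * levyExponent z) := by
  have := hS.stationary_increments s (t - s)
  rw [add_tsub_cancel_of_le hst] at this
  rw [this, hS.charFun_eq, NNReal.coe_sub hst]

lemma IsPetersburgProcess.charFun_stepSum [IsProbabilityMeasure μ] (hS : IsPetersburgProcess S μ)
    {t : ℕ → ℝ≥0} (ht : Monotone t) (α : ℕ → ℝ) (s : Finset ℕ) (z : ℝ) :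
    charFun (μ.map fun ω => ∑ i ∈ s, α i * (S (t (i + 1)) ω - S (t i) ω)) z =
      Complex.exp (∑ i ∈ s, ((t (i + 1) : ℝ) - t i : ℝ) * levyExponent (α i * z)) := by
  have hm : ∀ i, Measurable fun ω => S (t (i + 1)) ω - S (t i) ω := fun i =>
    (hS.measurable _).sub (hS.measurable _)
  have hind : iIndepFun (fun i ω => α i * (S (t (i + 1)) ω - S (t i) ω)) μ :=
    (hS.indep_increments.nat ht).comp (fun i x => α i * x) (fun i => by fun_prop)
  rw [iIndepFun.charFun_map_fun_finsetSum_eq_prod (fun i _ => ((hm i).const_mul _).aemeasurable)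
    (hind.restrict _), Finset.prod_apply, Complex.exp_sum]
  refine Finset.prod_congr rfl fun i _ => ?_
  rw [charFun_map_mul_comp (hm i).aemeasurable, hS.charFun_sub (ht (Nat.le_succ i))]

end Increments

end Petersburg

/-! ### Riemann–Stieltjes sums are Cauchy in probability -/

namespace Petersburg

/-- `t` with tags `ξ` is a tagged partition of `[0, T]` into `n` intervals, of mesh at most `δ`. -/
structure IsTaggedPartition (T δ : ℝ≥0) (n : ℕ) (t ξ : ℕ → ℝ≥0) : Prop where
  mono : Monotone t
  zero : t 0 = 0
  last : t n = T
  mesh : ∀ i < n, t (i + 1) ≤ t i + δ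
  tag : ∀ i < n, ξ i ∈ Set.Icc (t i) (t (i + 1))

/-- The Riemann-Stieltjes sum of `f` with respect to `s`. -/
def stieltjesSum (f s : ℝ≥0 → ℝ) (n : ℕ) (t ξ : ℕ → ℝ≥0) : ℝ :=
  ∑ i ∈ Finset.range n, f (ξ i) * (s (t (i + 1)) - s (t i))

/-- Multiplying an increment by the indicator of being left of `u q` amounts to stopping both
endpoints at `u q`, and the stopped increments telescope. Repeated points of `u` do no harm. -/
lemma sum_indicator_mul_increment (s : ℝ≥0 → ℝ) {u : ℕ → ℝ≥0} (hu : Monotone u) {q m : ℕ}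
    (hq : q ≤ m) :
    ∑ j ∈ Finset.range m, (if u j < u q then (1 : ℝ) else 0) * (s (u (j + 1)) - s (u j)) =
      s (u q) - s (u 0) := by
  have : ∀ j, (if u j < u q then (1 : ℝ) else 0) * (s (u (j + 1)) - s (u j)) =
      s (min (u (j + 1)) (u q)) - s (min (u j) (u q)) := by
    intro j
    split_ifs with h
    · have hj : j < q := hu.reflect_lt h
      rw [min_eq_left (hu hj), min_eq_left h.le, one_mul]
    · push Not at h
      rw [min_eq_right h, min_eq_right (h.trans (hu (Nat.le_succ j)))]
      simp
  simp_rw [this]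
  rw [Finset.sum_range_sub (fun j => s (min (u j) (u q))), min_eq_right (hu hq),
    min_eq_left (hu (Nat.zero_le q))]

/-- The step function with value `f (ξ i)` on `[t i, t (i + 1))`. -/
noncomputable def stepFun (f : ℝ≥0 → ℝ) (n : ℕ) (t ξ : ℕ → ℝ≥0) (x : ℝ≥0) : ℝ :=
  ∑ i ∈ Finset.range n, f (ξ i) * ((if x < t (i + 1) then 1 else 0) - if x < t i then 1 else 0)

/-- A Riemann–Stieltjes sum depends only on its step function and may be evaluated on any
refinement; two sums thus become comparable term by term. -/
lemma sum_stepFun_mul_increment (f s : ℝ≥0 → ℝ) {n : ℕ} {t ξ : ℕ → ℝ≥0} {u : ℕ → ℝ≥0}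
    (hu : Monotone u) {m : ℕ} (hut : ∀ i ≤ n, ∃ q ≤ m, u q = t i) :
    ∑ j ∈ Finset.range m, stepFun f n t ξ (u j) * (s (u (j + 1)) - s (u j)) =
      stieltjesSum f s n t ξ := by
  have key : ∀ i ≤ n, ∑ j ∈ Finset.range m, (if u j < t i then (1 : ℝ) else 0) *
      (s (u (j + 1)) - s (u j)) = s (t i) - s (u 0) := by
    intro i hi
    obtain ⟨q, hq, h⟩ := hut i hi
    rw [← h]
    exact sum_indicator_mul_increment s hu hq
  simp_rw [stepFun, Finset.sum_mul]
  rw [Finset.sum_comm, stieltjesSum]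
  refine Finset.sum_congr rfl fun i hi => ?_
  have hi' := Finset.mem_range.1 hi
  simp_rw [mul_assoc, sub_mul]
  rw [← Finset.mul_sum, Finset.sum_sub_distrib, key _ hi', key _ hi'.le]
  ring

/-- The differences of indicators are nonnegative and telescope to the indicator of [0, T), so the
error is a weighted average of |f(ξ_i) - f(x)|, with x in the cell of ξ_i. -/
lemma abs_stepFun_sub_le {f : ℝ≥0 → ℝ} {L : ℝ} (hL : 0 ≤ L)
    (hf : ∀ x y : ℝ≥0, |f x - f y| ≤ L * |(x : ℝ) - y|) {T δ : ℝ≥0} {n : ℕ} {t ξ : ℕ → ℝ≥0}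
    (h : IsTaggedPartition T δ n t ξ) (x : ℝ≥0) :
    |stepFun f n t ξ x - f x * if x < T then 1 else 0| ≤ L * δ := by
  have tele : ∑ i ∈ Finset.range n,
      ((if x < t (i + 1) then (1 : ℝ) else 0) - if x < t i then 1 else 0) =
      if x < T then 1 else 0 := by
    rw [Finset.sum_range_sub (fun i => if x < t i then (1 : ℝ) else 0), h.last, h.zero]
    simp
  rw [stepFun, ← tele, Finset.mul_sum, ← Finset.sum_sub_distrib]
  refine (Finset.abs_sum_le_sum_abs _ _).trans ?_
  have : ∀ i ∈ Finset.range n, |f (ξ i) * ((if x < t (i + 1) then (1 : ℝ) else 0) -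
      if x < t i then 1 else 0) - f x * ((if x < t (i + 1) then (1 : ℝ) else 0) -
      if x < t i then 1 else 0)| ≤ L * δ * ((if x < t (i + 1) then (1 : ℝ) else 0) -
      if x < t i then 1 else 0) := by
    intro i hi
    have hi := Finset.mem_range.1 hi
    have hm := h.mono (Nat.le_succ i)
    by_cases h1 : x < t (i + 1)
    · by_cases h2 : x < t i
      · simp [h1, h2]
      · push Not at h2
        simp only [h1, h2.not_gt, if_true, if_false, sub_zero, mul_one]
        refine (hf _ _).trans ?_
        gcongr
        obtain ⟨h3, h4⟩ := h.tag i hi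
        have h5 := h.mesh i hi
        have h1 : (x : ℝ) < t (i + 1) := h1
        have h2 : (t i : ℝ) ≤ x := h2
        have h3 : (t i : ℝ) ≤ ξ i := h3
        have h4 : (ξ i : ℝ) ≤ t (i + 1) := h4
        have h5 : (t (i + 1) : ℝ) ≤ t i + δ := by exact_mod_cast h5
        rw [abs_le]; constructor <;> linarith
    · have h2 : ¬ x < t i := fun h2 => h1 (h2.trans_le hm)
      simp [h1, h2]
  refine (Finset.sum_le_sum this).trans ?_
  rw [← Finset.mul_sum, tele]
  split_ifs <;> simp
  positivity

lemma exists_monotone_enum (F : Finset ℝ≥0) (hF : F.Nonempty) :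
    ∃ (u : ℕ → ℝ≥0) (m : ℕ), Monotone u ∧ (∀ j, u j ∈ F) ∧ ∀ x ∈ F, ∃ q ≤ m, u q = x := by
  have hk : 0 < F.card := hF.card_pos
  -- Past the last element the enumeration stays constant, hence is monotone on all of ℕ.
  refine ⟨fun j => F.orderEmbOfFin rfl ⟨min j (F.card - 1), by omega⟩, F.card - 1, ?_, ?_, ?_⟩
  · intro i j hij
    simp only [OrderEmbedding.le_iff_le, Fin.mk_le_mk]
    omega
  · exact fun j => F.orderEmbOfFin_mem rfl _
  · intro x hx
    obtain ⟨⟨q, hq⟩, rfl⟩ : x ∈ Set.range (F.orderEmbOfFin rfl) := by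
      rw [Finset.range_orderEmbOfFin]; exact hx
    exact ⟨q, by omega, by simp only [min_eq_left (show q ≤ F.card - 1 by omega)]⟩

/-- The difference of two Riemann-Stieltjes sums over fine tagged partitions is a
sum over a common refinement, with small coefficients. -/
lemma exists_stieltjesSum_sub_eq {f : ℝ≥0 → ℝ} {L : ℝ} (hL : 0 ≤ L)
    (hf : ∀ x y : ℝ≥0, |f x - f y| ≤ L * |(x : ℝ) - y|) {T δ : ℝ≥0}
    {n n' : ℕ} {t ξ t' ξ' : ℕ → ℝ≥0}
    (h : IsTaggedPartition T δ n t ξ) (h' : IsTaggedPartition T δ n' t' ξ') :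
    ∃ (u : ℕ → ℝ≥0) (m : ℕ) (α : ℕ → ℝ), Monotone u ∧ u m ≤ T ∧ (∀ j, |α j| ≤ 2 * L * δ) ∧
      ∀ s : ℝ≥0 → ℝ, stieltjesSum f s n t ξ - stieltjesSum f s n' t' ξ' =
        ∑ j ∈ Finset.range m, α j * (s (u (j + 1)) - s (u j)) := by
  classical
  let F := (Finset.range (n + 1)).image t ∪ (Finset.range (n' + 1)).image t'
  have hF : F.Nonempty := ⟨t 0, Finset.mem_union_left _ (Finset.mem_image_of_mem _ (by simp))⟩
  obtain ⟨u, m, hu, huF, hq⟩ := exists_monotone_enum F hF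
  refine ⟨u, m, fun j => stepFun f n t ξ (u j) - stepFun f n' t' ξ' (u j), hu, ?_, ?_, ?_⟩
  · have := huF m
    simp only [F, Finset.mem_union, Finset.mem_image, Finset.mem_range] at this
    obtain ⟨i, hi, h1⟩ | ⟨i, hi, h1⟩ := this
    · rw [← h1, ← h.last]; exact h.mono (by omega)
    · rw [← h1, ← h'.last]; exact h'.mono (by omega)
  · intro j
    have h1 := abs_le.1 (abs_stepFun_sub_le hL hf h (u j))
    have h2 := abs_le.1 (abs_stepFun_sub_le hL hf h' (u j))
    rw [abs_le]
    constructor <;> linarith [h1.1, h1.2, h2.1, h2.2]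
  · intro s
    rw [← sum_stepFun_mul_increment f s (t := t) hu fun i hi => hq _ (Finset.mem_union_left _
        (Finset.mem_image_of_mem _ (by simpa [Nat.lt_succ_iff] using hi))),
      ← sum_stepFun_mul_increment f s (t := t') hu fun i hi => hq _ (Finset.mem_union_right _
        (Finset.mem_image_of_mem _ (by simpa [Nat.lt_succ_iff] using hi))),
      ← Finset.sum_sub_distrib]
    exact Finset.sum_congr rfl fun j _ => by ring

variable {Ω : Type*} [MeasurableSpace Ω] {μ : Measure Ω} {S : ℝ≥0 → Ω → ℝ}

lemma isIntegralOn_iff {f : ℝ≥0 → ℝ} {T : ℝ≥0} {I : Ω → ℝ} :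
    IsIntegralOn f S μ T I ↔ AEMeasurable I μ ∧ ∀ ε : ℝ, 0 < ε → ∀ η : ℝ, 0 < η →
      ∃ δ : ℝ≥0, 0 < δ ∧ ∀ n t ξ, IsTaggedPartition T δ n t ξ →
        μ {ω | ε ≤ |stieltjesSum f (S · ω) n t ξ - I ω|} ≤ ENNReal.ofReal η := by
  refine and_congr_right fun _ => forall₄_congr fun ε _ η _ => exists_congr fun δ =>
    and_congr_right fun _ => ?_
  exact ⟨fun h n t ξ ht => h n t ξ ht.mono ht.zero ht.last ht.mesh ht.tag,
    fun h n t ξ h1 h2 h3 h4 h5 => h n t ξ ⟨h1, h2, h3, h4, h5⟩⟩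

lemma IsPetersburgProcess.measurable_stieltjesSum (hS : IsPetersburgProcess S μ)
    (f : ℝ≥0 → ℝ) (n : ℕ) (t ξ : ℕ → ℝ≥0) :
    Measurable fun ω => stieltjesSum f (S · ω) n t ξ :=
  Finset.measurable_sum _ fun _ _ => ((hS.measurable _).sub (hS.measurable _)).const_mul _

lemma norm_sum_increment_mul_levyExponent_le {u : ℕ → ℝ≥0} (hu : Monotone u) {m : ℕ} {T : ℝ≥0}
    (hm : u m ≤ T) {α : ℕ → ℝ} {β : ℝ} (hα : ∀ j, |α j| ≤ β) :
    ‖∑ j ∈ Finset.range m, (((u (j + 1) : ℝ) - u j : ℝ) : ℂ) * levyExponent (α j)‖ ≤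
      T * (levyConst * modulus β) := by
  have hβ : 0 ≤ β := (abs_nonneg _).trans (hα 0)
  have hC : 0 ≤ levyConst * modulus β := mul_nonneg levyConst_nonneg (modulus_nonneg β)
  calc _ ≤ ∑ j ∈ Finset.range m, ((u (j + 1) : ℝ) - u j) * (levyConst * modulus β) := by
        refine norm_sum_le_of_le _ fun j _ => ?_
        have h1 : (0 : ℝ) ≤ (u (j + 1) : ℝ) - u j :=
          sub_nonneg.2 (NNReal.coe_le_coe.2 (hu (Nat.le_succ j)))
        rw [norm_mul, Complex.norm_real, Real.norm_of_nonneg h1]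
        gcongr
        refine (norm_levyExponent_le _).trans ?_
        have := levyConst_nonneg
        gcongr
        exact modulus_mono ((hα j).trans (le_abs_self β))
    _ = ((u m : ℝ) - u 0) * (levyConst * modulus β) := by
        rw [← Finset.sum_mul, Finset.sum_range_sub (fun j => (u j : ℝ))]
    _ ≤ _ := by
        gcongr
        have : (u m : ℝ) ≤ T := hm
        linarith [(u 0).coe_nonneg]

/-- Riemann-Stieltjes sums are Cauchy in probability as the mesh tends to zero. -/
lemma IsPetersburgProcess.stieltjesSum_cauchy [IsProbabilityMeasure μ]
    (hS : IsPetersburgProcess S μ) {f : ℝ≥0 → ℝ} {L : ℝ} (hL : 0 ≤ L)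
    (hf : ∀ x y : ℝ≥0, |f x - f y| ≤ L * |(x : ℝ) - y|) (T : ℝ≥0)
    {ε η : ℝ} (hε : 0 < ε) (hη : 0 < η) :
    ∃ δ : ℝ≥0, 0 < δ ∧ ∀ n t ξ n' t' ξ', IsTaggedPartition T δ n t ξ →
      IsTaggedPartition T δ n' t' ξ' →
      μ {ω | ε ≤ |stieltjesSum f (S · ω) n t ξ - stieltjesSum f (S · ω) n' t' ξ'|} ≤
        ENNReal.ofReal η := by
  -- The refinement has coefficients at most 2Lδ, and the tail bound at ε only involves |z| ≤ 4/ε;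
  -- this quantity bounds the exponent there.
  have hlim : Tendsto (fun δ : ℝ≥0 => T * (levyConst * modulus (2 * L * δ * (4 / ε))))
      (𝓝[>] 0) (𝓝 0) := by
    have : Continuous fun δ : ℝ≥0 => T * (levyConst * modulus (2 * L * δ * (4 / ε))) := by
      have := continuous_modulus
      fun_prop
    refine Tendsto.mono_left ?_ nhdsWithin_le_nhds
    simpa using this.tendsto 0
  obtain ⟨δ, hδ, hδ0⟩ := ((hlim.eventually_le_const (u := min 1 (η / 4)) (by positivity)).and
    self_mem_nhdsWithin).exists
  refine ⟨δ, hδ0, fun n t ξ n' t' ξ' h h' => ?_⟩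
  obtain ⟨u, m, α, hu, hum, hα, hdiff⟩ := exists_stieltjesSum_sub_eq hL hf h h'
  have hmeas := ((hS.measurable_stieltjesSum f n t ξ).sub
    (hS.measurable_stieltjesSum f n' t' ξ')).aemeasurable (μ := μ)
  have := measure_le_abs_of_charFun_eq_exp (X := fun ω => stieltjesSum f (S · ω) n t ξ -
      stieltjesSum f (S · ω) n' t' ξ') hmeas
    (w := fun z => ∑ j ∈ Finset.range m,
      (((u (j + 1) : ℝ) - u j : ℝ) : ℂ) * levyExponent (α j * z)) (fun z => by
        simp_rw [hdiff]
        exact hS.charFun_stepSum hu α _ z) hε (κ := min 1 (η / 4)) (min_le_left _ _) fun z hz => by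
      refine (norm_sum_increment_mul_levyExponent_le hu hum (fun j => ?_)).trans hδ
      rw [abs_mul]
      have := hα j
      gcongr
  refine this.trans (ENNReal.ofReal_le_ofReal ?_)
  linarith [min_le_right 1 (η / 4)]

/-- The partition of `[0, T]` into `n` intervals of equal length. -/
noncomputable def uniformPartition (T : ℝ≥0) (n i : ℕ) : ℝ≥0 := i / n * T

lemma isTaggedPartition_uniformPartition {T δ : ℝ≥0} {n : ℕ} (hn : n ≠ 0) (hδ : T / n ≤ δ) :
    IsTaggedPartition T δ n (uniformPartition T n) (uniformPartition T n) := by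
  have hmono : Monotone (uniformPartition T n) := fun i j hij => by
    unfold uniformPartition; gcongr
  have hn' : (n : ℝ≥0) ≠ 0 := by exact_mod_cast hn
  refine ⟨hmono, by simp [uniformPartition], ?_, fun i _ => ?_, fun i _ =>
    ⟨le_rfl, hmono (Nat.le_succ i)⟩⟩
  · simp [uniformPartition, hn']
  · calc uniformPartition T n (i + 1) = uniformPartition T n i + T / n := by
          unfold uniformPartition; push_cast; field_simp
      _ ≤ _ := by gcongr

lemma IsPetersburgProcess.exists_isIntegralOn [IsProbabilityMeasure μ]
    (hS : IsPetersburgProcess S μ) {f : ℝ≥0 → ℝ} {L : ℝ} (hL : 0 ≤ L)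
    (hf : ∀ x y : ℝ≥0, |f x - f y| ≤ L * |(x : ℝ) - y|) (T : ℝ≥0) :
    ∃ I, IsIntegralOn f S μ T I := by
  have hmesh : ∀ δ : ℝ≥0, 0 < δ → ∀ᶠ n : ℕ in atTop,
      IsTaggedPartition T δ n (uniformPartition T n) (uniformPartition T n) := by
    intro δ hδ
    have : Tendsto (fun n : ℕ => T / (n : ℝ≥0)) atTop (𝓝 0) :=
      tendsto_const_div_atTop_nhds_zero_nat T
    filter_upwards [this.eventually_le_const hδ, eventually_ne_atTop 0] with n h1 h2
    exact isTaggedPartition_uniformPartition h2 h1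
  obtain ⟨I, hI, hlim⟩ := exists_tendstoInMeasure_of_cauchy (μ := μ)
    (X := fun n ω => stieltjesSum f (S · ω) n (uniformPartition T n) (uniformPartition T n))
    (fun n => (hS.measurable_stieltjesSum f n _ _).aemeasurable) fun ε hε η hη => by
      obtain ⟨δ, hδ, h⟩ := hS.stieltjesSum_cauchy hL hf T hε hη
      obtain ⟨N, hN⟩ := eventually_atTop.1 (hmesh δ hδ)
      exact ⟨N, fun m hm n hn => h _ _ _ _ _ _ (hN m hm) (hN n hn)⟩
  refine ⟨I, isIntegralOn_iff.2 ⟨hI.aemeasurable, fun ε hε η hη => ?_⟩⟩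
  obtain ⟨δ, hδ, h⟩ := hS.stieltjesSum_cauchy hL hf T (half_pos hε) (half_pos hη)
  refine ⟨δ, hδ, fun n t ξ ht => ?_⟩
  obtain ⟨N, hN, hN'⟩ := ((hmesh δ hδ).and
    (tendstoInMeasure_iff_abs.1 hlim _ (half_pos hε) _ (half_pos hη))).exists
  have := measure_le_abs_add (h _ _ _ _ _ _ ht hN) hN'
  rw [← ENNReal.ofReal_add (by positivity) (by positivity)] at this
  simpa using this

end Petersburg

/-! ### The characteristic function of an integral over [A, B] -/

namespace Petersburg

/-- Left Riemann sums of a continuous function over uniform partitions converge. -/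
lemma tendsto_riemannSum {F : ℝ → ℂ} (hF : Continuous F) {A B : ℝ} (hAB : A ≤ B) :
    Tendsto (fun n : ℕ => ∑ i ∈ Finset.range n, ((B - A) / n : ℝ) * F (A + i / n * (B - A)))
      atTop (𝓝 (∫ t in A..B, F t)) := by
  have huc := isCompact_Icc.uniformContinuousOn_of_continuous (hF.continuousOn (s := Set.Icc A B))
  rw [Metric.uniformContinuousOn_iff] at huc
  rw [Metric.tendsto_atTop]
  intro ε hε
  -- The summand 1 keeps the denominator positive when A = B.
  obtain ⟨δ, hδ, h⟩ := huc (ε / (B - A + 1)) (by have := sub_nonneg.2 hAB; positivity)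
  have hmesh : Tendsto (fun n : ℕ => (B - A) / (n : ℝ)) atTop (𝓝 0) :=
    tendsto_const_div_atTop_nhds_zero_nat _
  obtain ⟨N, hN⟩ := eventually_atTop.1 ((hmesh.eventually_lt_const hδ).and (eventually_ne_atTop 0))
  refine ⟨N, fun n hn => ?_⟩
  obtain ⟨hn1, hn0⟩ := hN n hn
  have hBA : 0 ≤ B - A := sub_nonneg.2 hAB
  have hn0' : (0 : ℝ) < n := by exact_mod_cast Nat.pos_of_ne_zero hn0
  set p : ℕ → ℝ := fun i => A + i / n * (B - A) with hp
  have hp1 : ∀ i, p (i + 1) - p i = (B - A) / n := fun i => by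
    simp only [hp]; push_cast; field_simp; ring
  have hpA : p 0 = A := by simp [hp]
  have hpB : p n = B := by simp only [hp]; field_simp; ring
  have hpmono : Monotone p := fun i j hij => by simp only [hp]; gcongr
  have hint : ∫ t in A..B, F t = ∑ i ∈ Finset.range n, ∫ t in p i..p (i + 1), F t := by
    rw [intervalIntegral.sum_integral_adjacent_intervals
      (fun i _ => hF.intervalIntegrable _ _), hpA, hpB]
  rw [hint, dist_eq_norm, ← Finset.sum_sub_distrib]
  have hterm : ∀ i ∈ Finset.range n, ‖((B - A) / n : ℝ) * F (p i) - ∫ t in p i..p (i + 1), F t‖ ≤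
      ε / (B - A + 1) * ((B - A) / n) := by
    intro i hi
    have hi := Finset.mem_range.1 hi
    have e : ((B - A) / n : ℝ) * F (p i) = ∫ t in p i..p (i + 1), F (p i) := by
      rw [intervalIntegral.integral_const, hp1, Complex.real_smul]
    rw [e, ← intervalIntegral.integral_sub (by simp) (hF.intervalIntegrable _ _)]
    have hle : p i ≤ p (i + 1) := hpmono (Nat.le_succ i)
    refine (intervalIntegral.norm_integral_le_of_norm_le_const (C := ε / (B - A + 1))
      fun t ht => ?_).trans_eq ?_
    · rw [Set.uIoc_of_le hle] at ht
      have h1 : A ≤ p i := hpA ▸ hpmono (Nat.zero_le i)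
      have h2 : p (i + 1) ≤ B := hpB ▸ hpmono hi
      rw [← dist_eq_norm]
      refine (h _ ⟨h1, hle.trans h2⟩ t ⟨h1.trans ht.1.le, ht.2.trans h2⟩ ?_).le
      rw [dist_comm, Real.dist_eq, abs_of_pos (sub_pos.2 ht.1)]
      linarith [ht.2, hp1 i]
    · rw [hp1, abs_of_nonneg (by positivity)]
  refine (norm_sum_le_of_le _ hterm).trans_lt ?_
  rw [Finset.sum_const, Finset.card_range, nsmul_eq_mul]
  calc (n : ℝ) * (ε / (B - A + 1) * ((B - A) / n)) = ε * ((B - A) / (B - A + 1)) := by field_simp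
    _ < ε * 1 := by gcongr; rw [div_lt_one (by positivity)]; linarith
    _ = ε := mul_one ε

/-- The partition of `[0, B]` dividing both `[0, A]` and `[A, B]` into `n` equal intervals. -/
noncomputable def splitPartition (A B : ℝ≥0) (n i : ℕ) : ℝ≥0 :=
  (min i n : ℕ) / n * A + (i - n : ℕ) / n * (B - A)

section

variable {A B δ : ℝ≥0} {n : ℕ}

lemma splitPartition_add (hn : n ≠ 0) (i : ℕ) :
    splitPartition A B n (n + i) = A + i / n * (B - A) := by
  have : (n : ℝ≥0) ≠ 0 := by exact_mod_cast hn
  simp [splitPartition, this]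

lemma monotone_splitPartition : Monotone (splitPartition A B n) := fun i j hij => by
  unfold splitPartition; gcongr

lemma splitPartition_succ_le (hAB : A ≤ B) (hδ : B / n ≤ δ) (i : ℕ) :
    splitPartition A B n (i + 1) ≤ splitPartition A B n i + δ := by
  refine le_trans ?_ (add_le_add_right hδ _)
  unfold splitPartition
  rcases lt_or_ge i n with h | h
  · rw [min_eq_left (show i + 1 ≤ n from h), min_eq_left h.le, Nat.sub_eq_zero_of_le h,
      Nat.sub_eq_zero_of_le h.le]
    calc _ = (i : ℝ≥0) / n * A + A / n := by push_cast; simp; field_simp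
      _ ≤ (i : ℝ≥0) / n * A + B / n := by gcongr
      _ = _ := by simp
  · rw [min_eq_right (show n ≤ i + 1 by omega), min_eq_right h, Nat.sub_add_comm h]
    generalize i - n = k
    calc _ = (n : ℝ≥0) / n * A + k / n * (B - A) + (B - A) / n := by push_cast; ring
      _ ≤ _ := by gcongr; exact tsub_le_self

lemma isTaggedPartition_splitPartition_left (hn : n ≠ 0) (hAB : A ≤ B) (hδ : B / n ≤ δ) :
    IsTaggedPartition A δ n (splitPartition A B n) (splitPartition A B n) where
  mono := monotone_splitPartition
  zero := by simp [splitPartition]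
  last := by simpa using splitPartition_add (A := A) (B := B) hn 0
  mesh i _ := splitPartition_succ_le hAB hδ i
  tag i _ := ⟨le_rfl, monotone_splitPartition (Nat.le_succ i)⟩

lemma isTaggedPartition_splitPartition (hn : n ≠ 0) (hAB : A ≤ B) (hδ : B / n ≤ δ) :
    IsTaggedPartition B δ (n + n) (splitPartition A B n) (splitPartition A B n) where
  mono := monotone_splitPartition
  zero := by simp [splitPartition]
  last := by
    have : (n : ℝ≥0) ≠ 0 := by exact_mod_cast hn
    rw [splitPartition_add hn, div_self this, one_mul, add_tsub_cancel_of_le hAB]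
  mesh i _ := splitPartition_succ_le hAB hδ i
  tag i _ := ⟨le_rfl, monotone_splitPartition (Nat.le_succ i)⟩

/-- The first n points are already a partition of [0, A], so the two sums share their first n terms
and only increments over [A, B] remain. -/
lemma stieltjesSum_splitPartition_sub (f s : ℝ≥0 → ℝ) :
    stieltjesSum f s (n + n) (splitPartition A B n) (splitPartition A B n) -
      stieltjesSum f s n (splitPartition A B n) (splitPartition A B n) =
      ∑ i ∈ Finset.range n, f (splitPartition A B n (n + i)) *
        (s (splitPartition A B n (n + (i + 1))) - s (splitPartition A B n (n + i))) := by
  rw [stieltjesSum, stieltjesSum, Finset.sum_range_add, add_sub_cancel_left]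
  rfl

lemma eventually_div_le (B : ℝ≥0) (hδ : 0 < δ) : ∀ᶠ n : ℕ in atTop, n ≠ 0 ∧ B / n ≤ δ := by
  have : Tendsto (fun n : ℕ => B / (n : ℝ≥0)) atTop (𝓝 0) :=
    tendsto_const_div_atTop_nhds_zero_nat B
  exact (eventually_ne_atTop 0).and (this.eventually_le_const hδ)

end

variable {Ω : Type*} [MeasurableSpace Ω] {μ : Measure Ω} {S : ℝ≥0 → Ω → ℝ}

lemma tendstoInMeasure_stieltjesSum_sub {f : ℝ≥0 → ℝ} {A B : ℝ≥0} (hAB : A ≤ B) {I J : Ω → ℝ}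
    (hI : IsIntegralOn f S μ A I) (hJ : IsIntegralOn f S μ B J) :
    TendstoInMeasure μ (fun n ω => ∑ i ∈ Finset.range n, f (splitPartition A B n (n + i)) *
      (S (splitPartition A B n (n + (i + 1))) ω - S (splitPartition A B n (n + i)) ω)) atTop
      (fun ω => J ω - I ω) := by
  rw [isIntegralOn_iff] at hI hJ
  rw [tendstoInMeasure_iff_abs]
  intro ε hε η hη
  obtain ⟨δ, hδ, h⟩ := hI.2 _ (half_pos hε) _ (half_pos hη)
  obtain ⟨δ', hδ', h'⟩ := hJ.2 _ (half_pos hε) _ (half_pos hη)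
  filter_upwards [eventually_div_le B hδ, eventually_div_le B hδ'] with n ⟨hn, h1⟩ ⟨_, h2⟩
  have h3 := h _ _ _ (isTaggedPartition_splitPartition_left hn hAB h1)
  have h4 := h' _ _ _ (isTaggedPartition_splitPartition hn hAB h2)
  simp_rw [← abs_neg (stieltjesSum f _ n _ _ - _)] at h3
  have := measure_le_abs_add h4 h3
  rw [← ENNReal.ofReal_add (by positivity) (by positivity), add_halves] at this
  convert this using 6 with ω
  rw [← stieltjesSum_splitPartition_sub f (S · ω)]
  ring

lemma IsPetersburgProcess.charFun_integral_sub [IsProbabilityMeasure μ]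
    (hS : IsPetersburgProcess S μ) {φ : ℝ → ℝ} (hφ : Continuous φ)
    {A B : ℝ≥0} (hAB : A ≤ B) {I J : Ω → ℝ}
    (hI : IsIntegralOn (fun t => φ t) S μ A I) (hJ : IsIntegralOn (fun t => φ t) S μ B J) (z : ℝ) :
    charFun (μ.map fun ω => J ω - I ω) z =
      Complex.exp (∫ t in (A : ℝ)..B, levyExponent (z * φ t)) := by
  have h1 := tendsto_charFun_of_tendstoInMeasure (fun n => (Finset.measurable_sum _ fun _ _ =>
    ((hS.measurable _).sub (hS.measurable _)).const_mul _).aemeasurable)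
    (tendstoInMeasure_stieltjesSum_sub hAB hI hJ) z
  refine tendsto_nhds_unique h1 ?_
  have h2 := (Complex.continuous_exp.tendsto _).comp (tendsto_riemannSum
    (F := fun t => levyExponent (z * φ t)) (continuous_levyExponent.comp (by fun_prop))
    (NNReal.coe_le_coe.2 hAB))
  refine h2.congr' ?_
  filter_upwards [eventually_ne_atTop 0] with n hn
  refine Eq.trans ?_ (hS.charFun_stepSum (t := fun i => splitPartition A B n (n + i))
    (fun i j hij => monotone_splitPartition (by omega))
    (fun i => φ (splitPartition A B n (n + i))) (Finset.range n) z).symm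
  have hn' : (n : ℝ) ≠ 0 := by exact_mod_cast hn
  simp only [Function.comp, splitPartition_add hn]
  congr 1
  refine Finset.sum_congr rfl fun i _ => ?_
  push_cast [NNReal.coe_sub hAB]
  rw [mul_comm (φ _) z]
  congr 1
  field_simp
  ring

/-- Allows A = 0 in the formula for the increments of the integral. -/
lemma isIntegralOn_zero (f : ℝ≥0 → ℝ) : IsIntegralOn f S μ 0 fun _ => 0 := by
  refine isIntegralOn_iff.2 ⟨aemeasurable_const, fun ε hε η hη =>
    ⟨1, one_pos, fun n t ξ h => ?_⟩⟩
  have ht : ∀ i ≤ n, t i = 0 := fun i hi => le_antisymm (h.last ▸ h.mono hi) zero_le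
  have hs : ∀ ω, stieltjesSum f (S · ω) n t ξ = 0 := fun ω => by
    refine Finset.sum_eq_zero fun i hi => ?_
    have hi := Finset.mem_range.1 hi
    rw [ht _ hi, ht _ hi.le]; simp
  simp [hs, hε.not_ge]

/-! ### The exponential integrand and the limit as T tends to infinity -/

section Exponential

variable {a : ℝ}

lemma abs_exp_neg_mul_sub_le (ha : 0 < a) (x y : ℝ≥0) :
    |Real.exp (-2 * a * x) - Real.exp (-2 * a * y)| ≤ 2 * a * |(x : ℝ) - y| := by
  wlog h : x ≤ y generalizing x y
  · rw [abs_sub_comm, abs_sub_comm (x : ℝ)]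
    exact this y x (le_of_not_ge h)
  have h : (x : ℝ) ≤ y := h
  have h1 : Real.exp (-2 * a * y) ≤ Real.exp (-2 * a * x) := by
    apply Real.exp_le_exp.2; nlinarith
  rw [abs_of_nonneg (sub_nonneg.2 h1), abs_of_nonpos (sub_nonpos.2 h)]
  have h2 := Real.add_one_le_exp (-2 * a * (y - x))
  have h3 : Real.exp (-2 * a * x) ≤ 1 := Real.exp_le_one_iff.2 (by
    have := mul_nonneg ha.le x.coe_nonneg; linarith)
  have h4 : Real.exp (-2 * a * y) = Real.exp (-2 * a * x) * Real.exp (-2 * a * (y - x)) := by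
    rw [← Real.exp_add]; ring_nf
  rw [h4]
  have h5 : 0 ≤ 2 * a * (y - x) := mul_nonneg (by positivity) (by linarith)
  nlinarith [Real.exp_pos (-2 * a * x)]

variable [IsProbabilityMeasure μ] (hS : IsPetersburgProcess S μ) (ha : 0 < a)
include hS ha

lemma IsPetersburgProcess.charFun_exp_integral_sub {A B : ℝ≥0} (hAB : A ≤ B) {I J : Ω → ℝ}
    (hI : IsIntegralOn (fun t => Real.exp (-2 * a * t)) S μ A I)
    (hJ : IsIntegralOn (fun t => Real.exp (-2 * a * t)) S μ B J) (z : ℝ) :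
    charFun (μ.map fun ω => J ω - I ω) z = Complex.exp
      ((g (z * Real.exp (-2 * a * A)) - g (z * Real.exp (-2 * a * B))) / (2 * a)) := by
  rw [hS.charFun_integral_sub (φ := fun t => Real.exp (-2 * a * t)) (by fun_prop) hAB hI hJ z]
  have := integral_levyExponent_mul_exp (b := 2 * a) (by positivity) z A B
  simp only [← neg_mul] at this
  rw [this]
  push_cast
  rfl

lemma IsPetersburgProcess.exp_integral_cauchy {I : ℝ≥0 → Ω → ℝ}
    (hI : ∀ T, IsIntegralOn (fun t => Real.exp (-2 * a * t)) S μ T (I T))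
    {ε η : ℝ} (hε : 0 < ε) (hη : 0 < η) :
    ∃ N : ℕ, ∀ A ≥ (N : ℝ≥0), ∀ B ≥ (N : ℝ≥0),
      μ {ω | ε ≤ |I A ω - I B ω|} ≤ ENNReal.ofReal η := by
  have hκ : 0 < min 1 (η / 4) := by positivity
  -- Half of 2a · min(1, η/4): the exponent is a difference of two values of g, divided by 2a.
  obtain ⟨ρ, hρ, h⟩ := Metric.tendsto_nhds_nhds.1 tendsto_g_zero (a * min 1 (η / 4))
    (by positivity)
  have hlim : Tendsto (fun n : ℕ => 4 / ε * Real.exp (-2 * a * n)) atTop (𝓝 0) := by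
    have : Tendsto (fun n : ℕ => Real.exp (-2 * a * n)) atTop (𝓝 0) := by
      refine Real.tendsto_exp_atBot.comp ?_
      exact tendsto_natCast_atTop_atTop.const_mul_atTop_of_neg (by linarith)
    simpa using this.const_mul (4 / ε)
  obtain ⟨N, hN⟩ := (hlim.eventually_lt_const hρ).exists
  have hsmall : ∀ z : ℝ, |z| ≤ 4 / ε → ∀ A ≥ (N : ℝ≥0),
      ‖g (z * Real.exp (-2 * a * A))‖ ≤ a * min 1 (η / 4) := by
    intro z hz A hA
    have hA : (N : ℝ) ≤ A := by exact_mod_cast hA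
    have := h (x := z * Real.exp (-2 * a * A)) (by
      rw [dist_zero_right, Real.norm_eq_abs, abs_mul, Real.abs_exp]
      refine lt_of_le_of_lt ?_ hN
      have : Real.exp (-2 * a * A) ≤ Real.exp (-2 * a * N) := Real.exp_le_exp.2 (by nlinarith)
      gcongr)
    rw [dist_zero_right] at this
    exact this.le
  have key : ∀ A ≥ (N : ℝ≥0), ∀ B ≥ A, μ {ω | ε ≤ |I B ω - I A ω|} ≤ ENNReal.ofReal η := by
    intro A hA B hAB
    refine (measure_le_abs_of_charFun_eq_exp ((hI B).1.sub (hI A).1)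
      (hS.charFun_exp_integral_sub ha hAB (hI A) (hI B)) hε (κ := min 1 (η / 4))
      (min_le_left _ _) fun z hz => ?_).trans (ENNReal.ofReal_le_ofReal ?_)
    · have e : ‖(2 * a : ℂ)‖ = 2 * a := by simp [abs_of_pos ha]
      rw [norm_div, e, div_le_iff₀ (by positivity)]
      refine (norm_sub_le _ _).trans ?_
      linarith [hsmall z hz A hA, hsmall z hz B (hA.le.trans hAB)]
    · linarith [min_le_right 1 (η / 4)]
  refine ⟨N, fun A hA B hB => ?_⟩
  rcases le_total A B with hAB | hAB
  · simp_rw [abs_sub_comm (I A _)]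
    exact key A hA B hAB
  · exact key B hB A hAB

lemma IsPetersburgProcess.exists_isImproperIntegral :
    ∃ U, IsImproperIntegral (fun t => Real.exp (-2 * a * t)) S μ U := by
  choose I hI using fun T => hS.exists_isIntegralOn (f := fun t : ℝ≥0 => Real.exp (-2 * a * t))
    (L := 2 * a) (by positivity) (abs_exp_neg_mul_sub_le ha) T
  obtain ⟨U, hU, hlim⟩ := exists_tendstoInMeasure_of_cauchy (μ := μ) (X := fun n => I n)
    (fun n => (hI n).1) fun ε hε η hη => by
      obtain ⟨N, hN⟩ := hS.exp_integral_cauchy ha hI hε hη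
      exact ⟨N, fun m hm n hn => hN m (by exact_mod_cast hm) n (by exact_mod_cast hn)⟩
  refine ⟨U, hU.aemeasurable, I, hI, tendstoInMeasure_iff_abs.2 fun ε hε η hη => ?_⟩
  obtain ⟨N, hN⟩ := hS.exp_integral_cauchy ha hI (half_pos hε) (half_pos hη)
  obtain ⟨n, hn, hn'⟩ := ((eventually_ge_atTop N).and
    (tendstoInMeasure_iff_abs.1 hlim _ (half_pos hε) _ (half_pos hη))).exists
  filter_upwards [eventually_ge_atTop (N : ℝ≥0)] with T hT
  have := measure_le_abs_add (hN T hT n (by exact_mod_cast hn)) hn'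
  rw [← ENNReal.ofReal_add (by positivity) (by positivity)] at this
  simpa using this

lemma IsPetersburgProcess.charFun_improperIntegral {U : Ω → ℝ}
    (hU : IsImproperIntegral (fun t => Real.exp (-2 * a * t)) S μ U) (z : ℝ) :
    charFun (μ.map U) z = Complex.exp (g z / (2 * a)) := by
  obtain ⟨_, I, hI, hlim⟩ := hU
  have h1 := tendsto_charFun_of_tendstoInMeasure (X := fun n : ℕ => I n) (fun n => (hI n).1)
    (hlim.comp tendsto_natCast_atTop_atTop) z
  refine tendsto_nhds_unique h1 ?_
  have h2 : ∀ n : ℕ, charFun (μ.map (I n)) z =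
      Complex.exp ((g z - g (z * Real.exp (-2 * a * n))) / (2 * a)) := fun n => by
    have := hS.charFun_exp_integral_sub ha zero_le (isIntegralOn_zero _) (hI n) z
    simpa using this
  simp_rw [h2]
  have h3 : Tendsto (fun n : ℕ => z * Real.exp (-2 * a * n)) atTop (𝓝 0) := by
    have : Tendsto (fun n : ℕ => Real.exp (-2 * a * n)) atTop (𝓝 0) := by
      refine Real.tendsto_exp_atBot.comp ?_
      exact tendsto_natCast_atTop_atTop.const_mul_atTop_of_neg (by linarith)
    simpa using this.const_mul z
  have h4 := ((tendsto_g_zero.comp h3).const_sub (g z)).div_const (2 * a : ℂ)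
  rw [sub_zero] at h4
  exact (Complex.continuous_exp.tendsto _).comp h4

/-- The n-th root is the law of the same integral with na in place of a, whose exponent is g/(2na).
-/
lemma IsPetersburgProcess.isInfinitelyDivisible_improperIntegral {U : Ω → ℝ}
    (hU : IsImproperIntegral (fun t => Real.exp (-2 * a * t)) S μ U) :
    IsInfinitelyDivisible (μ.map U) := by
  intro n hn
  have hn' : (0 : ℝ) < n := by exact_mod_cast hn
  obtain ⟨V, hV⟩ := hS.exists_isImproperIntegral (mul_pos hn' ha)
  have hprobV : IsProbabilityMeasure (μ.map V) := Measure.isProbabilityMeasure_map hV.1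
  have hprobU : IsProbabilityMeasure (μ.map U) := Measure.isProbabilityMeasure_map hU.1
  refine ⟨μ.map V, hprobV, ?_⟩
  have : IsProbabilityMeasure (iidSumLaw (μ.map V) n) :=
    Measure.isProbabilityMeasure_map (by fun_prop)
  refine Measure.ext_of_charFun (funext fun z => ?_)
  rw [iidSumLaw, charFun_map_sum_pi_eq_prod, hS.charFun_improperIntegral ha hU]
  have hn0 : (n : ℂ) ≠ 0 := by exact_mod_cast hn.ne'
  simp only [Finset.prod_const, Finset.card_univ, Fintype.card_fin, Pi.pow_apply]
  rw [hS.charFun_improperIntegral (mul_pos hn' ha) hV, ← Complex.exp_nat_mul]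
  congr 1
  push_cast
  rcases eq_or_ne (a : ℂ) 0 with h | h
  · simp [h]
  · field_simp

end Exponential

end Petersburg

/-! ### Compound Poisson laws -/

namespace Petersburg

section CompoundPoisson

lemma isProbabilityMeasure_iidSumLaw (ρ : Measure ℝ) [IsProbabilityMeasure ρ] (n : ℕ) :
    IsProbabilityMeasure (iidSumLaw ρ n) :=
  Measure.isProbabilityMeasure_map (by fun_prop)

lemma charFun_iidSumLaw (ρ : Measure ℝ) [IsProbabilityMeasure ρ] (n : ℕ) (z : ℝ) :
    charFun (iidSumLaw ρ n) z = charFun ρ z ^ n := by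
  rw [iidSumLaw, charFun_map_sum_pi_eq_prod]
  simp

/-- `iidSumLaw ρ` as a Markov kernel. -/
noncomputable def iidSumKernel (ρ : Measure ℝ) : Kernel ℕ ℝ := ⟨iidSumLaw ρ, measurable_from_nat⟩

instance (ρ : Measure ℝ) [IsProbabilityMeasure ρ] : IsMarkovKernel (iidSumKernel ρ) :=
  ⟨fun n => isProbabilityMeasure_iidSumLaw ρ n⟩

instance (r : ℝ≥0) (ρ : Measure ℝ) [IsProbabilityMeasure ρ] :
    IsProbabilityMeasure ((poissonMeasure r).bind (iidSumLaw ρ)) :=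
  inferInstanceAs (IsProbabilityMeasure ((poissonMeasure r).bind (iidSumKernel ρ)))

/-- The characteristic function of a compound Poisson law. -/
lemma charFun_compoundPoisson (r : ℝ≥0) (ρ : Measure ℝ) [IsProbabilityMeasure ρ] (z : ℝ) :
    charFun ((poissonMeasure r).bind (iidSumLaw ρ)) z =
      Complex.exp (r * (charFun ρ z - 1)) := by
  have hint : Integrable (fun p : ℕ × ℝ => Complex.exp (z * p.2 * Complex.I))
      ((poissonMeasure r) ⊗ₘ (iidSumKernel ρ)) := by
    refine Integrable.of_bound (C := 1) (by fun_prop) (.of_forall fun p => ?_)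
    rw [← Complex.ofReal_mul, Complex.norm_exp_ofReal_mul_I]
  have hsnd : (poissonMeasure r).bind (iidSumLaw ρ) =
      ((poissonMeasure r) ⊗ₘ (iidSumKernel ρ)).map Prod.snd :=
    (Measure.snd_compProd (poissonMeasure r) (iidSumKernel ρ)).symm
  have h : charFun ((poissonMeasure r).bind (iidSumLaw ρ)) z =
      ∫ n, charFun ρ z ^ n ∂poissonMeasure r := by
    rw [charFun_apply_real, hsnd, integral_map (by fun_prop) (by fun_prop),
      Measure.integral_compProd hint]
    refine integral_congr_ae (.of_forall fun n => ?_)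
    exact (charFun_apply_real z).symm.trans (charFun_iidSumLaw ρ n z)
  rw [h, integral_poissonMeasure]
  calc ∑' n : ℕ, (Real.exp (-r) * r ^ n / n.factorial : ℝ) • charFun ρ z ^ n
      = ∑' n : ℕ, (Real.exp (-r) : ℂ) * ((r * charFun ρ z) ^ n / n.factorial) := by
        congr with n
        rw [Complex.real_smul, mul_pow]
        push_cast
        ring
    _ = Real.exp (-r) * Complex.exp (r * charFun ρ z) := by
        rw [tsum_mul_left, (NormedSpace.expSeries_div_hasSum_exp (r * charFun ρ z)).tsum_eq,
          Complex.exp_eq_exp_ℂ]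
    _ = Complex.exp (r * (charFun ρ z - 1)) := by
        rw [Complex.ofReal_exp, ← Complex.exp_add]
        push_cast
        ring_nf

/-- The law on `(1, 2)` with density proportional to `1 / x`. -/
noncomputable def jumpLaw : Measure ℝ :=
  (volume.restrict (Set.Ioc (1 : ℝ) 2)).withDensity fun x => ENNReal.ofReal ((x * Real.log 2)⁻¹)

lemma integral_jumpLaw (F : ℝ → ℂ) :
    ∫ x, F x ∂jumpLaw = (Real.log 2 : ℂ)⁻¹ * ∫ x in (1 : ℝ)..2, F x / x := by
  rw [jumpLaw, integral_withDensity_eq_integral_toReal_smul (by fun_prop)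
    (.of_forall fun x => ENNReal.ofReal_lt_top), intervalIntegral.integral_of_le (by norm_num),
    ← integral_const_mul]
  refine setIntegral_congr_fun measurableSet_Ioc fun x hx => ?_
  have hx0 : 0 < x := by linarith [hx.1]
  have hlog := Real.log_pos one_lt_two
  rw [ENNReal.toReal_ofReal (by positivity), Complex.real_smul]
  push_cast
  rw [mul_inv]
  ring

instance : IsProbabilityMeasure jumpLaw := by
  have hlog := Real.log_pos one_lt_two
  refine ⟨?_⟩
  have hi : IntervalIntegrable (fun x : ℝ => (x * Real.log 2)⁻¹) volume 1 2 := by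
    refine ContinuousOn.intervalIntegrable (ContinuousOn.inv₀ (by fun_prop) fun x hx => ?_)
    rw [Set.uIcc_of_le (by norm_num)] at hx
    have : 0 < x := by linarith [hx.1]
    positivity
  rw [jumpLaw, withDensity_apply _ MeasurableSet.univ, Measure.restrict_univ,
    ← ofReal_integral_eq_lintegral_ofReal]
  · rw [← intervalIntegral.integral_of_le (by norm_num)]
    simp_rw [mul_inv]
    rw [intervalIntegral.integral_mul_const, integral_inv_of_pos one_pos two_pos, div_one,
      mul_inv_cancel₀ hlog.ne', ENNReal.ofReal_one]
  · exact (intervalIntegrable_iff_integrableOn_Ioc_of_le (by norm_num)).1 hi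
  · refine (ae_restrict_iff' measurableSet_Ioc).2 (.of_forall fun x hx => ?_)
    have : 0 < x := by linarith [hx.1]
    simp only [Pi.zero_apply]
    positivity

variable {a : ℝ}

/-- The intensity of the compound Poisson variable at scale `2 ^ l`. -/
noncomputable def jumpRate (a : ℝ) (l : ℤ) : ℝ≥0 :=
  Real.toNNReal ((2 : ℝ) ^ (-l) / (2 * a) * Real.log 2)

/-- The compound Poisson law at scale `2 ^ l`, shifted by the centering constant. -/
noncomputable def lawW (a : ℝ) (l : ℤ) : Measure ℝ :=
  ((poissonMeasure (jumpRate a l)).bind (iidSumLaw jumpLaw)).map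
    (· + -(c l * ((2 : ℝ) ^ (-l) / (2 * a))))

instance (a : ℝ) (l : ℤ) : IsProbabilityMeasure (lawW a l) :=
  Measure.isProbabilityMeasure_map (by fun_prop)

lemma isCompoundPoisson_lawW (ha : 0 < a) (l : ℤ) :
    IsCompoundPoisson ((lawW a l).map (· + c l * ((2 : ℝ) ^ (-l) / (2 * a)))) := by
  have hlog := Real.log_pos one_lt_two
  refine ⟨jumpRate a l, jumpLaw, Real.toNNReal_pos.2 (by positivity), inferInstance, ?_⟩
  rw [lawW, Measure.map_map (by fun_prop) (by fun_prop)]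
  have : ((· + c l * ((2 : ℝ) ^ (-l) / (2 * a))) ∘
    (· + -(c l * ((2 : ℝ) ^ (-l) / (2 * a))))) = id := by ext x; simp
  rw [this, Measure.map_id]

/-- The factor log 2 in the rate cancels the normalisation of `jumpLaw`. A jump has mean 1/log 2, so
the compound Poisson mean is 2^{-l}/(2a), which is the shift in `lawW` when c_l = 1. -/
lemma charFun_lawW (ha : 0 < a) (l : ℤ) (z : ℝ) : charFun (lawW a l) z = charFunW a l z := by
  have hlog := Real.log_pos one_lt_two
  have hlog' : (Real.log 2 : ℂ) ≠ 0 := by exact_mod_cast hlog.ne'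
  have hsub : ∀ x ∈ Set.uIcc (1 : ℝ) 2, (x : ℂ) ≠ 0 := fun x hx => by
    rw [Set.uIcc_of_le (by norm_num)] at hx
    have : x ≠ 0 := by linarith [hx.1]
    exact_mod_cast this
  have hci : ContinuousOn (fun x : ℝ => Complex.exp (z * x * Complex.I) / x) (Set.uIcc 1 2) :=
    ContinuousOn.div (by fun_prop) (by fun_prop) hsub
  have hcinv : ContinuousOn (fun x : ℝ => 1 / (x : ℂ)) (Set.uIcc 1 2) :=
    ContinuousOn.div (by fun_prop) (by fun_prop) hsub
  -- This is the total mass of `jumpLaw` being one.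
  have hone : ∫ x in (1 : ℝ)..2, 1 / (x : ℂ) = Real.log 2 := by
    have : (1 : ℂ) = (Real.log 2 : ℂ)⁻¹ * ∫ x in (1 : ℝ)..2, 1 / (x : ℂ) := by
      rw [← integral_jumpLaw]; simp
    rw [eq_inv_mul_iff_mul_eq₀ hlog', mul_one] at this
    exact this.symm
  have hsplit : (∫ x in (1 : ℝ)..2,
      (Complex.exp (Complex.I * z * x) - 1 - Complex.I * z * x * c l) / x) =
      (∫ x in (1 : ℝ)..2, Complex.exp (z * x * Complex.I) / x) - (∫ x in (1 : ℝ)..2, 1 / (x : ℂ))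
        - Complex.I * z * c l := by
    rw [← intervalIntegral.integral_sub hci.intervalIntegrable hcinv.intervalIntegrable]
    have : Complex.I * z * c l = ∫ x in (1 : ℝ)..2, Complex.I * z * c l := by
      rw [intervalIntegral.integral_const]; norm_num
    rw [this, ← intervalIntegral.integral_sub
      (hci.intervalIntegrable.sub hcinv.intervalIntegrable) (by simp)]
    refine intervalIntegral.integral_congr fun x hx => ?_
    have := hsub x hx
    rw [show Complex.I * z * x = z * x * Complex.I by ring]
    field_simp
  rw [lawW, charFun_map_add_const, charFun_compoundPoisson, charFun_apply_real, integral_jumpLaw,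
    ← Complex.exp_add, charFunW, hsplit, hone]
  congr 1
  rw [jumpRate, Real.coe_toNNReal _ (by positivity)]
  simp only [Real.inner_apply]
  have h2a : (a : ℂ) ≠ 0 := by exact_mod_cast ha.ne'
  simp only [Complex.ofReal_mul, Complex.ofReal_div, Complex.ofReal_neg, Complex.ofReal_zpow,
    Complex.ofReal_ofNat]
  generalize (∫ x in (1 : ℝ)..2, Complex.exp (z * x * Complex.I) / x) = J
  field_simp
  ring

end CompoundPoisson

/-! ### Almost sure convergence of the series -/

section Series

variable {Ω : Type*} [MeasurableSpace Ω] {μ : Measure Ω} [IsProbabilityMeasure μ]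

/-- The filter is general so as to cover finite subsets of ℤ ordered by inclusion, that is,
unconditional sums. -/
lemma tendsto_charFun_of_ae_tendsto {ι : Type*} {l : Filter ι} [l.IsCountablyGenerated]
    {X : ι → Ω → ℝ} {Y : Ω → ℝ} (hX : ∀ i, AEMeasurable (X i) μ) (hY : AEMeasurable Y μ)
    (h : ∀ᵐ ω ∂μ, Tendsto (fun i => X i ω) l (𝓝 (Y ω))) (z : ℝ) :
    Tendsto (fun i => charFun (μ.map (X i)) z) l (𝓝 (charFun (μ.map Y) z)) := by
  have e : ∀ {Z : Ω → ℝ}, AEMeasurable Z μ →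
      charFun (μ.map Z) z = ∫ ω, Complex.exp (z * Z ω * Complex.I) ∂μ := fun hZ => by
    rw [charFun_apply_real, integral_map hZ (by fun_prop)]
  simp_rw [e hY, fun i => e (hX i)]
  refine tendsto_integral_filter_of_dominated_convergence (fun _ => 1)
    (.of_forall fun i => ?_) (.of_forall fun i => .of_forall fun ω => ?_) (by simp) ?_
  · have := hX i
    exact (by fun_prop : AEMeasurable _ μ).aestronglyMeasurable
  · rw [← Complex.ofReal_mul, Complex.norm_exp_ofReal_mul_I]
  · filter_upwards [h] with ω hω
    exact ((by fun_prop : Continuous fun x : ℝ => Complex.exp (z * x * Complex.I)).tendsto _).comp hω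

/-- A series of random variables whose characteristic functions are close enough to `1` converges
absolutely, almost surely. -/
lemma ae_summable_of_charFun_eq_exp {X : ℤ → Ω → ℝ} (hX : ∀ l, AEMeasurable (X l) μ)
    {w : ℤ → ℝ → ℂ} (hw : ∀ l z, charFun (μ.map (X l)) z = Complex.exp (w l z)) {K : ℝ}
    (hK : 0 ≤ K) (hwK : ∀ l z, ‖w l z‖ ≤ K * modulus (2 * z) * (√2)⁻¹ ^ l.natAbs) :
    ∀ᵐ ω ∂μ, Summable fun l => X l ω := by
  -- At threshold r = (9/10)^{|l|} the exponent is needed for |z| ≤ 4/r, where the modulus grows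
  -- like r^{-2}. The ratio 9/10 is summable, yet close enough to 1 that q < 1.
  set q : ℝ := (√2)⁻¹ / (9 / 10) ^ 2 with hq
  have hq0 : 0 ≤ q := by positivity
  have hq1 : q < 1 := by
    rw [hq, div_lt_one (by norm_num), inv_lt_comm₀ (by positivity) (by norm_num), Real.lt_sqrt] <;>
      norm_num
  have hprob : ∀ l : ℤ, μ {ω | (9 / 10 : ℝ) ^ l.natAbs ≤ |X l ω|} ≤
      ENNReal.ofReal (512 * K * q ^ l.natAbs) := by
    intro l
    set r : ℝ := (9 / 10) ^ l.natAbs with hr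
    have hr0 : 0 < r := by positivity
    have hr1 : r ≤ 1 := pow_le_one₀ (by norm_num) (by norm_num)
    have hκ : ∀ z : ℝ, |z| ≤ 4 / r → ‖w l z‖ ≤ 128 * K * q ^ l.natAbs := by
      intro z hz
      have h1 := modulus_le_of_le_inv (r := r / 8) (z := 2 * z) (by positivity) (by linarith) (by
        rw [abs_mul, abs_of_pos (two_pos (α := ℝ)), inv_div]
        calc 2 * |z| ≤ 2 * (4 / r) := by gcongr
          _ = 8 / r := by ring)
      calc ‖w l z‖ ≤ K * modulus (2 * z) * (√2)⁻¹ ^ l.natAbs := hwK l z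
        _ ≤ K * (2 * (r / 8)⁻¹ ^ 2) * (√2)⁻¹ ^ l.natAbs := by gcongr
        _ = 128 * K * ((√2)⁻¹ ^ l.natAbs / r ^ 2) := by field_simp; ring
        _ = 128 * K * q ^ l.natAbs := by rw [hr, ← pow_mul, mul_comm _ 2, pow_mul, ← div_pow]
    -- The tail bound requires an exponent of size at most 1; otherwise the claimed bound exceeds 1
    -- and is trivial.
    by_cases h1 : 128 * K * q ^ l.natAbs ≤ 1
    · refine (measure_le_abs_of_charFun_eq_exp (hX l) (hw l) hr0 h1 hκ).trans_eq ?_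
      ring_nf
    · refine prob_le_one.trans ?_
      rw [ENNReal.one_le_ofReal]
      linarith
  have hsum : Summable fun l : ℤ => 512 * K * q ^ l.natAbs :=
    (summable_pow_natAbs hq0 hq1).mul_left _
  have hfin := ae_finite_setOfPred_mem (μ := μ)
    (s := fun l : ℤ => {ω | (9 / 10 : ℝ) ^ l.natAbs ≤ |X l ω|}) (by
      refine ne_top_of_le_ne_top ?_ (ENNReal.tsum_le_tsum hprob)
      rw [← ENNReal.ofReal_tsum_of_nonneg (fun l => by positivity) hsum]
      exact ENNReal.ofReal_ne_top)
  filter_upwards [hfin] with ω hω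
  refine Summable.of_norm_bounded_eventually
    (summable_pow_natAbs (q := 9 / 10) (by norm_num) (by norm_num)) ?_
  filter_upwards [hω.compl_mem_cofinite] with l hl
  have hl : ¬ (9 / 10 : ℝ) ^ l.natAbs ≤ |X l ω| := hl
  exact (not_le.1 hl).le

lemma exists_hasSum_of_charFun_eq_exp {X : ℤ → Ω → ℝ} (hX : ∀ l, Measurable (X l))
    (hind : iIndepFun X μ)
    {w : ℤ → ℝ → ℂ} (hw : ∀ l z, charFun (μ.map (X l)) z = Complex.exp (w l z)) {K : ℝ}
    (hK : 0 ≤ K) (hwK : ∀ l z, ‖w l z‖ ≤ K * modulus (2 * z) * (√2)⁻¹ ^ l.natAbs) :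
    ∃ V : Ω → ℝ, Measurable V ∧ (∀ᵐ ω ∂μ, HasSum (fun l => X l ω) (V ω)) ∧
      ∀ z, charFun (μ.map V) z = Complex.exp (∑' l, w l z) := by
  have hmeas : ∀ s : Finset ℤ, Measurable fun ω => ∑ l ∈ s, X l ω := fun s =>
    Finset.measurable_sum _ fun l _ => hX l
  obtain ⟨V, hV, hlim⟩ := measurable_limit_of_tendsto_metrizable_ae
    (L := (atTop : Filter (Finset ℤ))) (fun s => (hmeas s).aemeasurable (μ := μ)) (by
      filter_upwards [ae_summable_of_charFun_eq_exp (fun l => (hX l).aemeasurable) hw hK hwK]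
        with ω hω
      have := hω.hasSum
      rw [HasSum, SummationFilter.unconditional_filter] at this
      exact ⟨_, this⟩)
  refine ⟨V, hV, ?_, fun z => ?_⟩
  · filter_upwards [hlim] with ω hω
    rw [HasSum, SummationFilter.unconditional_filter]
    exact hω
  · have h1 := tendsto_charFun_of_ae_tendsto (fun s => (hmeas s).aemeasurable (μ := μ))
      hV.aemeasurable hlim z
    have h2 : ∀ s : Finset ℤ, charFun (μ.map fun ω => ∑ l ∈ s, X l ω) z =
        Complex.exp (∑ l ∈ s, w l z) := fun s => by
      rw [iIndepFun.charFun_map_fun_finsetSum_eq_prod (fun l _ => (hX l).aemeasurable)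
        (hind.restrict _), Finset.prod_apply, Complex.exp_sum]
      exact Finset.prod_congr rfl fun l _ => hw l z
    simp_rw [h2] at h1
    have hs : Summable fun l => w l z :=
      .of_norm_bounded (summable_inv_sqrt_two_pow.mul_left _) fun l => hwK l z
    have h3 := hs.hasSum
    rw [HasSum, SummationFilter.unconditional_filter] at h3
    exact tendsto_nhds_unique h1 ((Complex.continuous_exp.tendsto _).comp h3)

lemma charFunW_two_zpow_mul (a : ℝ) (l : ℤ) (z : ℝ) :
    charFunW a l (2 ^ l * z) = Complex.exp (gTerm z l / (2 * a)) := by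
  rw [charFunW, gTerm_eq, div_mul_eq_mul_div, ← intervalIntegral.integral_const_mul]
  congr 2
  refine intervalIntegral.integral_congr fun x _ => ?_
  simp only [levyTerm]
  push_cast
  rw [show Complex.I * (2 ^ l * z) * x = Complex.I * (z * x) * 2 ^ l by ring, mul_div_assoc]

lemma norm_gTerm_div_le {a : ℝ} (ha : 0 < a) (l : ℤ) (z : ℝ) :
    ‖gTerm z l / (2 * a)‖ ≤ 3 / (2 * a) * modulus (2 * z) * (√2)⁻¹ ^ l.natAbs := by
  have e : ‖(2 * a : ℂ)‖ = 2 * a := by simp [abs_of_pos ha]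
  rw [norm_div, e, div_le_iff₀ (by positivity)]
  refine (norm_gTerm_le z l).trans_eq ?_
  field_simp

end Series

/-! ### Enlarging the probability space -/

/-- A random variable distributed as `V`, a function on a standard Borel probability space, can be
realized as `V ∘ Y` with `Y` on an enlargement of its probability space. -/
lemma exists_enlargement {Ω : Type u} [MeasurableSpace Ω] {μ : Measure Ω} [IsProbabilityMeasure μ]
    {U : Ω → ℝ} (hU : AEMeasurable U μ) {E : Type} [MeasurableSpace E] [StandardBorelSpace E]
    [Nonempty E] {P : Measure E} [IsProbabilityMeasure P] {V : E → ℝ} (hV : Measurable V)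
    (hlaw : P.map V = μ.map U) :
    ∃ (Ω' : Type u) (_ : MeasurableSpace Ω') (μ' : Measure Ω') (π : Ω' → Ω) (Y : Ω' → E),
      IsProbabilityMeasure μ' ∧ MeasurePreserving π μ' μ ∧ Measurable Y ∧ μ'.map Y = P ∧
        ∀ᵐ ω ∂μ', V (Y ω) = U (π ω) := by
  set U' := hU.mk U
  have hU' : Measurable U' := hU.measurable_mk
  -- `κ v` is the law under `P` of a point of `E` given that `V` takes the value v. Given ω, the
  -- second coordinate is drawn from `κ (U' ω)`, so (U', e) gets the joint law of (V, e) under `P`.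
  let κ : Kernel ℝ E := condDistrib id V P
  let μ' : Measure (Ω × E) := μ ⊗ₘ κ.comap U' hU'
  have hfst : MeasurePreserving Prod.fst μ' μ :=
    ⟨measurable_fst, Measure.fst_compProd μ (κ.comap U' hU')⟩
  have hmap : μ'.map (fun p => (U' p.1, p.2)) = P.map fun e => (V e, e) := by
    have h1 : (P.map V) ⊗ₘ κ = P.map fun e => (V e, e) :=
      compProd_map_condDistrib aemeasurable_id
    rw [← h1, hlaw, Measure.map_congr hU.ae_eq_mk]
    ext s hs
    rw [Measure.map_apply (by fun_prop) hs, Measure.compProd_apply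
      ((by fun_prop : Measurable fun p : Ω × E => (U' p.1, p.2)) hs), Measure.compProd_apply hs,
      lintegral_map (Kernel.measurable_kernel_prodMk_left hs) hU']
    rfl
  have hpair : Measurable fun p : Ω × E => (U' p.1, p.2) := by fun_prop
  refine ⟨Ω × E, inferInstance, μ', Prod.fst, Prod.snd, inferInstance, hfst, measurable_snd, ?_, ?_⟩
  · have h2 : (Prod.snd : Ω × E → E) = Prod.snd ∘ fun p : Ω × E => (U' p.1, p.2) := rfl
    rw [h2, ← Measure.map_map measurable_snd hpair, hmap,
      Measure.map_map measurable_snd (by fun_prop)]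
    exact Measure.map_id
  · have h3 : ∀ᵐ p ∂(P.map fun e => (V e, e)), V p.2 = p.1 := by
      rw [ae_map_iff (by fun_prop) (measurableSet_eq_fun (by fun_prop) (by fun_prop))]
      exact .of_forall fun _ => rfl
    rw [← hmap] at h3
    filter_upwards [ae_of_ae_map hpair.aemeasurable h3, hfst.quasiMeasurePreserving.ae hU.ae_eq_mk]
      with p hp hp'
    rw [hp, hp']

end Petersburg

/-! ### The Lévy measure -/

namespace Petersburg

section LevyMeasure

variable {a : ℝ}

/-- The restriction of `levyMeasureU a` to the dyadic interval `(2 ^ l, 2 ^ (l + 1))`. -/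
noncomputable def levyPiece (a : ℝ) (l : ℤ) : Measure ℝ :=
  (volume.restrict (Set.Ioo ((2 : ℝ) ^ l) ((2 : ℝ) ^ (l + 1)))).withDensity
    (fun x => ENNReal.ofReal ((2 : ℝ) ^ (-l) / (2 * a * x)))

lemma levyMeasureU_eq (a : ℝ) : levyMeasureU a = Measure.sum (levyPiece a) := rfl

lemma levyMeasureU_singleton_zero (a : ℝ) : levyMeasureU a {0} = 0 := by
  rw [levyMeasureU_eq, Measure.sum_apply _ (measurableSet_singleton 0), ENNReal.tsum_eq_zero]
  intro l
  exact withDensity_absolutelyContinuous _ _ (by simp)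

/-- On the l-th interval min(1, x²) ≤ 4 min(1, 4^l), and 2^{-l} min(1, 4^l) ≤ 2^{-|l|}; dx/x has
mass of order one there. -/
lemma lintegral_min_levyPiece_le (ha : 0 < a) (l : ℤ) :
    ∫⁻ x, ENNReal.ofReal (min 1 (x ^ 2)) ∂levyPiece a l ≤
      ENNReal.ofReal (4 / (2 * a) * (1 / 2) ^ l.natAbs) := by
  have h2 : (0 : ℝ) < 2 ^ l := by positivity
  have h2n : (2 : ℝ) ^ (-l) = (2 ^ l)⁻¹ := zpow_neg _ _
  have h2s : (2 : ℝ) ^ (l + 1) = 2 * 2 ^ l := by rw [zpow_add_one₀ two_ne_zero, mul_comm]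
  rw [levyPiece, lintegral_withDensity_eq_lintegral_mul _ (by fun_prop) (by fun_prop)]
  have hbound : ∀ x ∈ Set.Ioo ((2 : ℝ) ^ l) (2 ^ (l + 1)),
      ENNReal.ofReal ((2 : ℝ) ^ (-l) / (2 * a * x)) * ENNReal.ofReal (min 1 (x ^ 2)) ≤
        ENNReal.ofReal ((2 : ℝ) ^ (-l) / (2 * a * 2 ^ l) * (4 * min 1 ((2 ^ l) ^ 2))) := by
    intro x hx
    have hx0 : 0 < x := h2.trans hx.1
    rw [← ENNReal.ofReal_mul (by positivity)]
    refine ENNReal.ofReal_le_ofReal ?_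
    have hm : min 1 (x ^ 2) ≤ 4 * min 1 ((2 ^ l) ^ 2) := by
      rw [mul_min_of_nonneg _ _ (by norm_num)]
      refine min_le_min (by norm_num) ?_
      have : x ≤ 2 * 2 ^ l := (hx.2.trans_eq h2s).le
      nlinarith
    have := hx.1.le
    gcongr
  refine (setLIntegral_mono' measurableSet_Ioo hbound).trans ?_
  rw [setLIntegral_const, Real.volume_Ioo, ← ENNReal.ofReal_mul (by positivity)]
  refine ENNReal.ofReal_le_ofReal ?_
  have key : (2 : ℝ) ^ (-l) * min 1 ((2 ^ l) ^ 2) ≤ (1 / 2) ^ l.natAbs := by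
    rcases le_total 0 l with hl | hl
    · lift l to ℕ using hl
      calc _ ≤ (2 : ℝ) ^ (-(l : ℤ)) * 1 := by gcongr; exact min_le_left _ _
        _ = _ := by simp
    · obtain ⟨n, rfl⟩ : ∃ n : ℕ, l = -n := ⟨l.natAbs, by omega⟩
      calc _ ≤ (2 : ℝ) ^ (-(-(n : ℤ))) * (2 ^ (-(n : ℤ))) ^ 2 := by gcongr; exact min_le_right _ _
        _ = _ := by simp; field_simp
  calc _ = 4 / (2 * a) * ((2 : ℝ) ^ (-l) * min 1 ((2 ^ l) ^ 2)) := by rw [h2s]; field_simp; ring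
    _ ≤ _ := by gcongr

lemma lintegral_min_levyMeasureU_lt_top (ha : 0 < a) :
    ∫⁻ x, ENNReal.ofReal (min 1 (x ^ 2)) ∂levyMeasureU a < ∞ := by
  rw [levyMeasureU_eq, lintegral_sum_measure]
  refine (ENNReal.tsum_le_tsum (lintegral_min_levyPiece_le ha)).trans_lt ?_
  rw [← ENNReal.ofReal_tsum_of_nonneg (fun l => by positivity)
    ((summable_pow_natAbs (by norm_num) (by norm_num)).mul_left _)]
  exact ENNReal.ofReal_lt_top

/-- The integrand of the Lévy-Khintchine formula, truncated at `1`. -/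
noncomputable def levyKhintchineIntegrand (z x : ℝ) : ℂ :=
  Complex.exp (Complex.I * z * x) - 1 -
    Set.indicator (Set.Icc (-1 : ℝ) 1) (fun y : ℝ => Complex.I * z * y) x

lemma norm_levyKhintchineIntegrand_le (z x : ℝ) :
    ‖levyKhintchineIntegrand z x‖ ≤ (2 + 3 * z ^ 2) * min 1 (x ^ 2) := by
  have e : Complex.I * z * x = Complex.I * ((z * x : ℝ) : ℂ) := by push_cast; ring
  unfold levyKhintchineIntegrand
  by_cases hx : x ∈ Set.Icc (-1 : ℝ) 1
  · rw [Set.indicator_of_mem hx, e, min_eq_right ((sq_le_one_iff_abs_le_one x).2 (abs_le.2 hx))]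
    refine (norm_exp_sub_one_sub_le_sq _).trans ?_
    nlinarith [sq_nonneg x]
  · have : 1 ≤ x ^ 2 := by
      by_contra! h
      exact hx (abs_le.1 ((sq_le_one_iff_abs_le_one x).1 h.le))
    rw [Set.indicator_of_notMem hx, e, min_eq_left this, sub_zero]
    calc _ ≤ ‖Complex.exp (Complex.I * ((z * x : ℝ) : ℂ))‖ + ‖(1 : ℂ)‖ := norm_sub_le _ _
      _ = 2 := by rw [mul_comm, Complex.norm_exp_ofReal_mul_I]; norm_num
      _ ≤ _ := by nlinarith [sq_nonneg z]

lemma integrable_levyKhintchineIntegrand (ha : 0 < a) (z : ℝ) :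
    Integrable (levyKhintchineIntegrand z) (levyMeasureU a) := by
  have h1 : Integrable (fun x : ℝ => (2 + 3 * z ^ 2) * min 1 (x ^ 2)) (levyMeasureU a) := by
    refine Integrable.const_mul ⟨by fun_prop, ?_⟩ _
    rw [hasFiniteIntegral_iff_ofReal (.of_forall fun x => by positivity)]
    exact lintegral_min_levyMeasureU_lt_top ha
  refine h1.mono' ?_ (.of_forall (norm_levyKhintchineIntegrand_le z))
  have : Measurable (levyKhintchineIntegrand z) := by
    unfold levyKhintchineIntegrand
    have : Measurable (Set.indicator (Set.Icc (-1 : ℝ) 1) fun y : ℝ => Complex.I * z * y) :=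
      Measurable.indicator (by fun_prop) measurableSet_Icc
    fun_prop
  exact this.aestronglyMeasurable

/-- Cutting off at |x| ≤ 1 agrees with the cut-off c_l on every dyadic interval except (1, 2), where
c_0 = 1 although x > 1. The missing compensator there integrates to iz/(2a). -/
lemma integral_levyPiece (ha : 0 < a) (z : ℝ) (l : ℤ) :
    ∫ x, levyKhintchineIntegrand z x ∂levyPiece a l =
      gTerm z l / (2 * a) + if l = 0 then Complex.I * z / (2 * a) else 0 := by
  have h2 : (0 : ℝ) < 2 ^ l := by positivity
  have hle : (2 : ℝ) ^ l ≤ 2 ^ (l + 1) := zpow_le_zpow_right₀ one_le_two (by omega)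
  have hac : (a : ℂ) ≠ 0 := by exact_mod_cast ha.ne'
  have hpos : ∀ x ∈ Set.uIcc ((2 : ℝ) ^ l) (2 ^ (l + 1)), (x : ℂ) ≠ 0 := fun x hx => by
    rw [Set.uIcc_of_le hle] at hx
    have : x ≠ 0 := (h2.trans_le hx.1).ne'
    exact_mod_cast this
  have hcont : IntervalIntegrable (fun x : ℝ =>
      (Complex.exp (Complex.I * z * x) - 1 - Complex.I * z * x * c l) / x) volume
      ((2 : ℝ) ^ l) (2 ^ (l + 1)) :=
    ContinuousOn.intervalIntegrable (ContinuousOn.div (by fun_prop) (by fun_prop) hpos)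
  have hF : ∀ x ∈ Set.Ioo ((2 : ℝ) ^ l) (2 ^ (l + 1)),
      (ENNReal.ofReal ((2 : ℝ) ^ (-l) / (2 * a * x))).toReal • levyKhintchineIntegrand z x =
      (2 : ℂ) ^ (-l) / (2 * a) * ((Complex.exp (Complex.I * z * x) - 1 -
        Complex.I * z * x * c l) / x + if l = 0 then Complex.I * z else 0) := by
    intro x hx
    have hx0 : 0 < x := h2.trans hx.1
    have hx0c : (x : ℂ) ≠ 0 := by exact_mod_cast hx0.ne'
    have hind : Set.indicator (Set.Icc (-1 : ℝ) 1) (fun y : ℝ => Complex.I * z * y) x =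
        Complex.I * z * x * c l - if l = 0 then Complex.I * z * x else 0 := by
      rcases lt_trichotomy l 0 with hl | hl | hl
      · have : x ≤ 1 := hx.2.le.trans (zpow_le_one_of_nonpos₀ one_le_two (by omega))
        have hm : x ∈ Set.Icc (-1 : ℝ) 1 := ⟨by linarith, this⟩
        rw [Set.indicator_of_mem hm]
        simp [c, hl.le, hl.ne]
      · subst hl
        have : ¬ x ≤ 1 := not_le.2 (by simpa using hx.1)
        rw [Set.indicator_of_notMem (fun h => this h.2)]
        simp [c]
      · have : ¬ x ≤ 1 := not_le.2 ((one_le_zpow₀ one_le_two hl.le).trans_lt hx.1)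
        rw [Set.indicator_of_notMem (fun h => this h.2)]
        simp [c, hl.not_ge, hl.ne']
    rw [levyKhintchineIntegrand, hind, ENNReal.toReal_ofReal (by positivity), Complex.real_smul]
    simp only [Complex.ofReal_mul, Complex.ofReal_div, Complex.ofReal_zpow, Complex.ofReal_ofNat]
    split_ifs
    · field_simp; ring
    · field_simp; ring
  rw [levyPiece, integral_withDensity_eq_integral_toReal_smul (by fun_prop)
    (.of_forall fun x => ENNReal.ofReal_lt_top), setIntegral_congr_fun measurableSet_Ioo hF,
    ← integral_Ioc_eq_integral_Ioo, ← intervalIntegral.integral_of_le hle,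
    intervalIntegral.integral_const_mul, intervalIntegral.integral_add hcont (by simp), gTerm,
    intervalIntegral.integral_const]
  split_ifs with hl
  · subst hl
    norm_num
    ring
  · simp only [smul_zero, add_zero]
    ring

lemma integral_levyMeasureU (ha : 0 < a) (z : ℝ) :
    ∫ x, levyKhintchineIntegrand z x ∂levyMeasureU a =
      (∑' l, gTerm z l) / (2 * a) + Complex.I * z / (2 * a) := by
  have h1 : HasSum (fun l => ∫ x, levyKhintchineIntegrand z x ∂levyPiece a l)
      (∫ x, levyKhintchineIntegrand z x ∂levyMeasureU a) :=
    hasSum_integral_measure (integrable_levyKhintchineIntegrand ha z)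
  simp_rw [integral_levyPiece ha] at h1
  exact h1.unique (((summable_gTerm z).hasSum.div_const _).add (hasSum_ite_eq 0 _))

lemma hasLevyMeasure_of_charFun_eq (ha : 0 < a) {m : Measure ℝ}
    (hm : ∀ z, charFun m z = Complex.exp (g z / (2 * a))) :
    HasLevyMeasure m (levyMeasureU a) := by
  -- The drift is 2/(2a) from g, less the 1/(2a) gained by changing the cut-off; there is no
  -- Gaussian part.
  refine ⟨levyMeasureU_singleton_zero a, lintegral_min_levyMeasureU_lt_top ha, 1 / (2 * a), 0,
    fun z => ?_⟩
  have := integral_levyMeasureU ha z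
  simp only [levyKhintchineIntegrand] at this
  rw [hm, this, g]
  congr 1
  push_cast
  ring

end LevyMeasure

/-! ### The series representation and the theorem -/

/-- A random variable with characteristic function `exp (g / (2 * a))` is a sum of independent
scaled centered compound Poisson variables, on an enlargement of the probability space. -/
lemma exists_compoundPoisson_series {Ω : Type u} [MeasurableSpace Ω] {μ : Measure Ω}
    [IsProbabilityMeasure μ] {a : ℝ} (ha : 0 < a) {U : Ω → ℝ} (hU : AEMeasurable U μ)
    (hchar : ∀ z, charFun (μ.map U) z = Complex.exp (g z / (2 * a))) :
    ∃ (Ω' : Type u) (_ : MeasurableSpace Ω') (μ' : Measure Ω') (π : Ω' → Ω) (W : ℤ → Ω' → ℝ),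
      IsProbabilityMeasure μ' ∧ MeasurePreserving π μ' μ ∧ (∀ l, Measurable (W l)) ∧
      iIndepFun W μ' ∧ (∀ l, μ'.map (W l) = lawW a l) ∧
      ∀ᵐ ω ∂μ', HasSum (fun l : ℤ => (2 : ℝ) ^ l * W l ω) (U (π ω) - 2 / (2 * a)) := by
  -- The sequence space is standard Borel, which the conditional distribution used for the
  -- enlargement needs.
  let P : Measure (ℤ → ℝ) := Measure.infinitePi (lawW a)
  have hPmap : ∀ l, P.map (fun x => x l) = lawW a l := fun l => Measure.infinitePi_map_eval _ l
  obtain ⟨V, hV, hsum, hVchar⟩ := exists_hasSum_of_charFun_eq_exp (μ := P)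
    (X := fun l x => (2 : ℝ) ^ l * x l) (fun l => by fun_prop)
    (iIndepFun_infinitePi (X := fun (l : ℤ) (x : ℝ) => (2 : ℝ) ^ l * x) fun l => by fun_prop)
    (w := fun l z => gTerm z l / (2 * a)) (fun l z => by
      rw [charFun_map_mul_comp (measurable_pi_apply l).aemeasurable, hPmap, charFun_lawW ha, charFunW_two_zpow_mul])
    (K := 3 / (2 * a)) (by positivity) (norm_gTerm_div_le ha)
  have : IsProbabilityMeasure (μ.map U) := Measure.isProbabilityMeasure_map hU
  have hV' : Measurable fun x => V x + 2 / (2 * a) := by fun_prop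
  have : IsProbabilityMeasure (P.map fun x => V x + 2 / (2 * a)) :=
    Measure.isProbabilityMeasure_map hV'.aemeasurable
  have hlaw : P.map (fun x => V x + 2 / (2 * a)) = μ.map U := by
    refine Measure.ext_of_charFun (funext fun z => ?_)
    have e : P.map (fun x => V x + 2 / (2 * a)) = (P.map V).map (· + 2 / (2 * a)) := by
      rw [Measure.map_map (by fun_prop) hV]; rfl
    rw [e, charFun_map_add_const, hVchar, hchar, ← Complex.exp_add, g, tsum_div_const,
      Real.inner_apply]
    congr 1
    push_cast
    ring
  obtain ⟨Ω', m', μ', π, Y, hprob, hπ, hY, hYlaw, hYU⟩ := exists_enlargement hU hV' hlaw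
  have hW : ∀ l, Measurable fun ω => Y ω l := fun l => by fun_prop
  have hWlaw : ∀ l, μ'.map (fun ω => Y ω l) = lawW a l := fun l => by
    rw [← hPmap l, ← hYlaw, Measure.map_map (by fun_prop) hY]; rfl
  refine ⟨Ω', m', μ', π, fun l ω => Y ω l, hprob, hπ, hW, ?_, hWlaw, ?_⟩
  · rw [iIndepFun_iff_map_fun_eq_infinitePi_map hW]
    simp_rw [hWlaw]
    exact hYlaw
  · rw [← hYlaw] at hsum
    filter_upwards [ae_of_ae_map hY.aemeasurable hsum, hYU] with ω h1 h2
    rwa [← h2, add_sub_cancel_right]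

end Petersburg

theorem lemma3p1 {Ω : Type u} [MeasurableSpace Ω] (μ : Measure Ω) [IsProbabilityMeasure μ]
    (S : ℝ≥0 → Ω → ℝ) (hS : Petersburg.IsPetersburgProcess S μ) (a : ℝ) (ha : 0 < a) :
    -- the integral exists, and so does the series in `g`
    (∃ U : Ω → ℝ, Petersburg.IsImproperIntegral (fun t => Real.exp (-2 * a * t)) S μ U) ∧
    (∀ z : ℝ, Summable (Petersburg.gTerm z)) ∧
    ∀ U : Ω → ℝ, Petersburg.IsImproperIntegral (fun t => Real.exp (-2 * a * t)) S μ U →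
      Petersburg.IsInfinitelyDivisible (μ.map U) ∧
      (∀ z : ℝ, charFun (μ.map U) z = Complex.exp (Petersburg.g z / (2 * a))) ∧
      Petersburg.HasLevyMeasure (μ.map U) (Petersburg.levyMeasureU a) ∧
      -- the representation of `U`, on an enlargement `π : Ω' → Ω` of the probability space;
      -- for `l ≤ 0` the compound Poisson variables are centered by their mean
      ∃ (Ω' : Type u) (_ : MeasurableSpace Ω') (μ' : Measure Ω') (π : Ω' → Ω) (W : ℤ → Ω' → ℝ),
        IsProbabilityMeasure μ' ∧ MeasurePreserving π μ' μ ∧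
        (∀ l, Measurable (W l)) ∧ iIndepFun W μ' ∧
        (∀ l, Petersburg.IsCompoundPoisson
          (μ'.map (fun ω => W l ω + Petersburg.c l * ((2 : ℝ) ^ (-l) / (2 * a))))) ∧
        (∀ (l : ℤ) (z : ℝ), charFun (μ'.map (W l)) z = Petersburg.charFunW a l z) ∧
        ∀ᵐ ω ∂μ', HasSum (fun l : ℤ => (2 : ℝ) ^ l * W l ω) (U (π ω) - 2 / (2 * a)) := by
  refine ⟨hS.exists_isImproperIntegral ha, Petersburg.summable_gTerm, fun U hU => ?_⟩
  have hchar := hS.charFun_improperIntegral ha hU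
  refine ⟨hS.isInfinitelyDivisible_improperIntegral ha hU, hchar,
    Petersburg.hasLevyMeasure_of_charFun_eq ha hchar, ?_⟩
  obtain ⟨Ω', m', μ', π, W, hprob, hπ, hW, hind, hlaw, hsum⟩ :=
    Petersburg.exists_compoundPoisson_series ha hU.1 hchar
  refine ⟨Ω', m', μ', π, W, hprob, hπ, hW, hind, fun l => ?_, fun l z => ?_, hsum⟩
  · have : μ'.map (fun ω => W l ω + Petersburg.c l * ((2 : ℝ) ^ (-l) / (2 * a))) =
        (Petersburg.lawW a l).map (· + Petersburg.c l * ((2 : ℝ) ^ (-l) / (2 * a))) := by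
      rw [← hlaw l, Measure.map_map (by fun_prop) (hW l)]; rfl
    rw [this]
    exact Petersburg.isCompoundPoisson_lawW ha l
  · rw [hlaw, Petersburg.charFun_lawW ha]
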